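/- Let $\mathbb K\in\{\mathbb R,\mathbb C\}$. An (abstract, possibly incomplete) operator space over $\mathbb K$ is a vector space $E$ with norms on all $M_n(E)$ satisfying Ruan's axioms $\|\alpha x\beta\|\le\|\alpha\|\,\|x\|\,\|\beta\|$ ($\alpha,\beta$ scalar matrices) and $\|x\oplus y\|=\max(\|x\|,\|y\|)$. A linear map between operator spaces is completely contractive (completely isometric) if it is contractive (isometric) on $M_n$ for every $n$. For a Hilbert space $H$, $\mathcal L(H)$ is an operator space via $M_n(\mathcal L(H))=\mathcal L(H^n)$. Let $\mathbf{OAlg}$ be the category of unital operator algebras: operator spaces $A$ with a unital algebra structure such that $\|xy\|\le\|x\|\,\|y\|$ on every $M_n(A)$ and $\|1\|=1$ unless $A=0$ (the zero algebra is allowed); morphisms are unital completely contractive homomorphisms. Let $\mathbf{NAlg}$ be the category of unital normed algebras (submultiplicative norm, $\|1\|=1$ unless the algebra is $0$, which is allowed) with unital contractive homomorphisms. Let $\mathbf{OAlg}^\wedge,\mathbf{NAlg}^\wedge$ be the full subcategories of complete objects. For $\bullet\in\{\text{blank},\wedge\}$ let $U:\mathbf{OAlg}^\bullet\to\mathbf{NAlg}^\bullet$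 be the forgetful functor. A functor is pre-monadic (respectively monadic) if it is a right adjoint and its comparison functor to the Eilenberg–Moore category of the induced monad is fully faithful (respectively an equivalence). Then, for both values of $\bullet$: (0) $U$ has a left adjoint. Suppose that $A\in\mathbf{OAlg}^\bullet$ admits, for some Hilbert space $H$, a unital contractive homomorphism $A\to\mathcal L(H)$ that is not completely contractive. Then: (1) for every left adjoint $F$ of $U$, the counit $FU(A)\to A$ is bijective but not completely isometric, and it is not a regular epimorphism in $\mathbf{OAlg}^\bullet$; (2) $A$ is the codomain of a bijective isometric morphism of $\mathbf{OAlg}^\bullet$ that is not completely isometric; (3) consequently $A$ witnesses the failure of pre-monadicity and monadicity of $U$: for some $B\in\mathbf{OAlg}^\bullet$ the comparison functor is not surjective on morphisms $A\to B$, and the morphism in (2) is a non-isomorphism that $U$ sends to an isomorphism; so $U$ is neither pre-monadic nor monadic. (4) For $n\ge3$, the algebra $P(\mathbb D^n)$ of complex polynomial functions in $n$ variables, with the operator algebra structure inherited from $C(\mathbb T^n)$, has a unital contractive homomorphism into some $\mathcal L(H)$, $H$ a complex Hilbert space, that is not completely contractive. (5) The functors $U:\mathbf{OAlg}^\bullet\to\mathbf{NAlg}^\bullet$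 are neither pre-monadic nor monadic. -/

import Mathlib

open CategoryTheory

universe u v

/-! ### Operator spaces and operator algebras -/

section OperatorSpaces

open scoped Matrix.Norms.L2Operator

/-- The product `α x β ∈ M_{p,q}(E)` of a matrix `x ∈ M_{m,n}(E)` over a vector space `E` with
scalar matrices `α` (on the left) and `β` (on the right). -/
def scalarConj {𝕜 E : Type*} [Semiring 𝕜] [AddCommMonoid E] [Module 𝕜 E] {m n p q : ℕ}
    (α : Matrix (Fin p) (Fin m) 𝕜) (x : Matrix (Fin m) (Fin n) E) (β : Matrix (Fin n) (Fin q) 𝕜) :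
    Matrix (Fin p) (Fin q) E :=
  Matrix.of fun i j => ∑ k, ∑ l, (α i k * β l j) • x k l

/-- The block-diagonal matrix `x ⊕ y ∈ M_{m+n}(E)`. -/
def blockDiag {E : Type*} [Zero E] {m n : ℕ} (x : Matrix (Fin m) (Fin m) E)
    (y : Matrix (Fin n) (Fin n) E) : Matrix (Fin (m + n)) (Fin (m + n)) E :=
  Matrix.reindex finSumFinEquiv finSumFinEquiv (Matrix.fromBlocks x 0 0 y)

/-- An (abstract, not necessarily complete) operator space structure on a normed space `E`: norms
`‖·‖ₙ` on all the matrix spaces `M_n(E)`, compatible with the given norm of `E = M_1(E)`, that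
satisfy Ruan's axioms. Scalar matrices carry the operator norm between Euclidean (Hilbert)
spaces. That every `‖·‖ₙ` is a norm, not only a seminorm, follows from the axioms, see
`OperatorSpace.eq_zero_of_mnorm_eq_zero`. -/
class OperatorSpace (𝕜 : Type*) [RCLike 𝕜] (E : Type*) [NormedAddCommGroup E]
    [NormedSpace 𝕜 E] where
  mnorm (n : ℕ) : Seminorm 𝕜 (Matrix (Fin n) (Fin n) E)
  mnorm_one (x : Matrix (Fin 1) (Fin 1) E) : mnorm 1 x = ‖x 0 0‖
  mnorm_scalarConj_le {m n : ℕ} (α : Matrix (Fin m) (Fin n) 𝕜) (x : Matrix (Fin n) (Fin n) E)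
    (β : Matrix (Fin n) (Fin m) 𝕜) : mnorm m (scalarConj α x β) ≤ ‖α‖ * mnorm n x * ‖β‖
  mnorm_blockDiag {m n : ℕ} (x : Matrix (Fin m) (Fin m) E) (y : Matrix (Fin n) (Fin n) E) :
    mnorm (m + n) (blockDiag x y) = max (mnorm m x) (mnorm n y)

/-- An (abstract, not necessarily complete) unital operator algebra: a unital algebra that is an
operator space, such that the multiplication is completely contractive (that is,
`‖x y‖ₙ ≤ ‖x‖ₙ ‖y‖ₙ` for the matrix product on `M_n(A)`), and the unit has norm `1`. The condition
on the unit is written as `‖1‖ ≤ 1`; it is equivalent to `‖1‖ = 1` unless `A` is the zero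
algebra, which is allowed. -/
class OperatorAlgebra (𝕜 : Type*) [RCLike 𝕜] (A : Type*) [NormedRing A] [NormedAlgebra 𝕜 A]
    extends OperatorSpace 𝕜 A where
  norm_one_le : ‖(1 : A)‖ ≤ 1
  mnorm_mul_le {n : ℕ} (x y : Matrix (Fin n) (Fin n) A) :
    mnorm n (x * y) ≤ mnorm n x * mnorm n y

namespace OperatorSpace

theorem norm_entry_le {𝕜 E : Type*} [RCLike 𝕜] [NormedAddCommGroup E] [NormedSpace 𝕜 E]
    [OperatorSpace 𝕜 E] {n : ℕ} (x : Matrix (Fin n) (Fin n) E) (i j : Fin n) :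
    ∃ C : ℝ, ‖x i j‖ ≤ C * mnorm (𝕜 := 𝕜) n x := by
  let α : Matrix (Fin 1) (Fin n) 𝕜 := Matrix.of fun _ k => if k = i then 1 else 0
  let β : Matrix (Fin n) (Fin 1) 𝕜 := Matrix.of fun l _ => if l = j then 1 else 0
  refine ⟨‖α‖ * ‖β‖, ?_⟩
  have h := mnorm_scalarConj_le (𝕜 := 𝕜) α x β
  rw [mnorm_one] at h
  have h2 : scalarConj α x β 0 0 = x i j := by
    simp [scalarConj, α, β, ite_smul]
  rw [h2] at h
  linarith

theorem eq_zero_of_mnorm_eq_zero {𝕜 E : Type*} [RCLike 𝕜] [NormedAddCommGroup E]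
    [NormedSpace 𝕜 E] [OperatorSpace 𝕜 E] {n : ℕ} (x : Matrix (Fin n) (Fin n) E)
    (h : mnorm (𝕜 := 𝕜) n x = 0) : x = 0 := by
  ext i j
  obtain ⟨C, hC⟩ := norm_entry_le (𝕜 := 𝕜) x i j
  rw [h, mul_zero] at hC
  simpa using hC

end OperatorSpace

/-- A linear map `f : E → F` of operator spaces is completely contractive if all its entrywise
amplifications `M_n(E) → M_n(F)` are contractive. -/
def IsCompletelyContractive (𝕜 : Type*) [RCLike 𝕜] {E F : Type*} [NormedAddCommGroup E]
    [NormedSpace 𝕜 E] [OperatorSpace 𝕜 E] [NormedAddCommGroup F] [NormedSpace 𝕜 F]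
    [OperatorSpace 𝕜 F] (f : E →ₗ[𝕜] F) : Prop :=
  ∀ (n : ℕ) (x : Matrix (Fin n) (Fin n) E),
    OperatorSpace.mnorm (𝕜 := 𝕜) n (x.map f) ≤ OperatorSpace.mnorm (𝕜 := 𝕜) n x

/-- A linear map `f : E → F` of operator spaces is completely isometric if all its entrywise
amplifications `M_n(E) → M_n(F)` are isometric. -/
def IsCompletelyIsometric (𝕜 : Type*) [RCLike 𝕜] {E F : Type*} [NormedAddCommGroup E]
    [NormedSpace 𝕜 E] [OperatorSpace 𝕜 E] [NormedAddCommGroup F] [NormedSpace 𝕜 F]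
    [OperatorSpace 𝕜 F] (f : E →ₗ[𝕜] F) : Prop :=
  ∀ (n : ℕ) (x : Matrix (Fin n) (Fin n) E),
    OperatorSpace.mnorm (𝕜 := 𝕜) n (x.map f) = OperatorSpace.mnorm (𝕜 := 𝕜) n x

end OperatorSpaces

/-! ### The operator space `L(H)` -/

noncomputable section BoundedOperators

open scoped Matrix.Norms.L2Operator

variable {𝕜 : Type*} [RCLike 𝕜] {H : Type*} [NormedAddCommGroup H] [InnerProductSpace 𝕜 H]

/-- The operator on the Hilbert space direct sum `Hⁿ` given by a matrix of operators on `H`. -/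
def opMatrix (n : ℕ) : Matrix (Fin n) (Fin n) (H →L[𝕜] H) →ₗ[𝕜]
    (PiLp 2 (fun _ : Fin n => H) →L[𝕜] PiLp 2 (fun _ : Fin n => H)) where
  toFun x := ((PiLp.continuousLinearEquiv 2 𝕜 (fun _ : Fin n => H)).symm :
      (Fin n → H) →L[𝕜] PiLp 2 (fun _ : Fin n => H)) ∘L
    ContinuousLinearMap.pi (fun i => ∑ j, x i j ∘L PiLp.proj 2 (fun _ : Fin n => H) j)
  map_add' x y := by
    ext v i
    simp [Finset.sum_add_distrib]
  map_smul' c x := by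
    ext v i
    simp [Finset.smul_sum]

theorem opMatrix_apply {n : ℕ} (x : Matrix (Fin n) (Fin n) (H →L[𝕜] H))
    (v : PiLp 2 (fun _ : Fin n => H)) (i : Fin n) : opMatrix n x v i = ∑ j, x i j (v j) := by
  simp [opMatrix]

theorem sum_norm_sq_scalar_le {m n : ℕ} (α : Matrix (Fin m) (Fin n) 𝕜) (h : Fin n → H) :
    ∑ i, ‖∑ j, α i j • h j‖ ^ 2 ≤ ‖α‖ ^ 2 * ∑ j, ‖h j‖ ^ 2 := by
  let S := Submodule.span 𝕜 (Set.range h)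
  have : FiniteDimensional 𝕜 S := FiniteDimensional.span_of_finite 𝕜 (Set.finite_range h)
  let b := stdOrthonormalBasis 𝕜 S
  let s : Fin n → S := fun j => ⟨h j, Submodule.subset_span ⟨j, rfl⟩⟩
  have hn : ∀ t : S, ‖(t : H)‖ ^ 2 = ∑ k, ‖b.repr t k‖ ^ 2 := fun t => by
    rw [← EuclideanSpace.norm_sq_eq, b.repr.norm_map]; rfl
  have h1 : ∀ i, ∑ j, α i j • h j = ((∑ j, α i j • s j : S) : H) := fun i => by
    simp [s]
  have h2 : ∀ j, h j = (s j : H) := fun j => rfl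
  simp_rw [h1]
  simp_rw [h2, hn]
  rw [Finset.sum_comm, Finset.sum_comm (f := fun j k => ‖b.repr (s j) k‖ ^ 2), Finset.mul_sum]
  refine Finset.sum_le_sum fun k _ => ?_
  have h3 := Matrix.l2_opNorm_mulVec α (WithLp.toLp 2 fun j => b.repr (s j) k)
  have h4 := pow_le_pow_left₀ (norm_nonneg _) h3 2
  rw [mul_pow, EuclideanSpace.norm_sq_eq, EuclideanSpace.norm_sq_eq] at h4
  refine le_trans (le_of_eq ?_) h4
  refine Finset.sum_congr rfl fun i _ => ?_
  simp [Matrix.mulVec, dotProduct]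

/-- The operator `Hⁿ → Hᵐ` given by a scalar matrix. -/
def scalarAmp {m n : ℕ} (α : Matrix (Fin m) (Fin n) 𝕜) :
    PiLp 2 (fun _ : Fin n => H) →L[𝕜] PiLp 2 (fun _ : Fin m => H) :=
  ((PiLp.continuousLinearEquiv 2 𝕜 (fun _ : Fin m => H)).symm :
      (Fin m → H) →L[𝕜] PiLp 2 (fun _ : Fin m => H)) ∘L
    ContinuousLinearMap.pi (fun i => ∑ j, α i j • PiLp.proj 2 (fun _ : Fin n => H) j)

theorem scalarAmp_apply {m n : ℕ} (α : Matrix (Fin m) (Fin n) 𝕜)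
    (v : PiLp 2 (fun _ : Fin n => H)) (i : Fin m) : scalarAmp α v i = ∑ j, α i j • v j := by
  simp [scalarAmp]

theorem norm_scalarAmp_le {m n : ℕ} (α : Matrix (Fin m) (Fin n) 𝕜) :
    ‖(scalarAmp α : PiLp 2 (fun _ : Fin n => H) →L[𝕜] PiLp 2 (fun _ : Fin m => H))‖ ≤ ‖α‖ := by
  refine ContinuousLinearMap.opNorm_le_bound _ (norm_nonneg _) fun v => ?_
  refine le_of_sq_le_sq ?_ (by positivity)
  rw [mul_pow, PiLp.norm_sq_eq_of_L2, PiLp.norm_sq_eq_of_L2]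
  simp_rw [scalarAmp_apply]
  exact sum_norm_sq_scalar_le α _

theorem opMatrix_scalarConj {m n : ℕ} (α : Matrix (Fin m) (Fin n) 𝕜)
    (x : Matrix (Fin n) (Fin n) (H →L[𝕜] H)) (β : Matrix (Fin n) (Fin m) 𝕜) :
    opMatrix m (scalarConj α x β) = scalarAmp α ∘L opMatrix n x ∘L scalarAmp β := by
  ext v i
  simp only [opMatrix_apply, scalarConj, ContinuousLinearMap.comp_apply, scalarAmp_apply,
    Matrix.of_apply, sum_apply, smul_apply, map_sum,
    map_smul, Finset.smul_sum]
  rw [Finset.sum_comm]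
  refine Finset.sum_congr rfl fun k _ => ?_
  rw [Finset.sum_comm]
  simp_rw [mul_smul]

theorem norm_opMatrix_blockDiag {m n : ℕ} (x : Matrix (Fin m) (Fin m) (H →L[𝕜] H))
    (y : Matrix (Fin n) (Fin n) (H →L[𝕜] H)) :
    ‖opMatrix (m + n) (blockDiag x y)‖ = max ‖opMatrix m x‖ ‖opMatrix n y‖ := by
  have key : ∀ v : PiLp 2 (fun _ : Fin (m + n) => H),
      ‖opMatrix (m + n) (blockDiag x y) v‖ ^ 2 =
        ‖opMatrix m x (WithLp.toLp 2 fun i => v (Fin.castAdd n i))‖ ^ 2 +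
        ‖opMatrix n y (WithLp.toLp 2 fun i => v (Fin.natAdd m i))‖ ^ 2 := fun v => by
    simp [PiLp.norm_sq_eq_of_L2, opMatrix_apply, Fin.sum_univ_add, blockDiag]
  have hv : ∀ v : PiLp 2 (fun _ : Fin (m + n) => H), ‖v‖ ^ 2 =
      ‖(WithLp.toLp 2 fun i => v (Fin.castAdd n i) : PiLp 2 (fun _ : Fin m => H))‖ ^ 2 +
      ‖(WithLp.toLp 2 fun i => v (Fin.natAdd m i) : PiLp 2 (fun _ : Fin n => H))‖ ^ 2 := fun v => by
    simp [PiLp.norm_sq_eq_of_L2, Fin.sum_univ_add]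
  refine le_antisymm ?_ (max_le ?_ ?_)
  · refine ContinuousLinearMap.opNorm_le_bound _ (by positivity) fun v => ?_
    refine le_of_sq_le_sq ?_ (by positivity)
    rw [mul_pow, key, hv, mul_add]
    refine add_le_add ?_ ?_
    · rw [← mul_pow]
      refine pow_le_pow_left₀ (norm_nonneg _) (((opMatrix m x).le_opNorm _).trans ?_) 2
      gcongr
      exact le_max_left _ _
    · rw [← mul_pow]
      refine pow_le_pow_left₀ (norm_nonneg _) (((opMatrix n y).le_opNorm _).trans ?_) 2
      gcongr
      exact le_max_right _ _
  · refine ContinuousLinearMap.opNorm_le_bound _ (norm_nonneg _) fun v => ?_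
    let w : PiLp 2 (fun _ : Fin (m + n) => H) := WithLp.toLp 2 (Fin.append (fun i => v i) 0)
    have h1 := hv w
    have h2 := key w
    have h3 := (opMatrix (m + n) (blockDiag x y)).le_opNorm w
    have e1 : (WithLp.toLp 2 fun i => w (Fin.castAdd n i) : PiLp 2 (fun _ : Fin m => H)) = v := by
      ext i; simp [w]
    have e2 : (WithLp.toLp 2 fun i => w (Fin.natAdd m i) : PiLp 2 (fun _ : Fin n => H)) = 0 := by
      ext i; simp [w]
    rw [e1, e2] at h1 h2
    simp only [map_zero, norm_zero, ne_eq, OfNat.ofNat_ne_zero, not_false_eq_true, zero_pow,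
      add_zero] at h1 h2
    rw [sq_eq_sq₀ (norm_nonneg _) (norm_nonneg _)] at h1 h2
    rwa [h1, h2] at h3
  · refine ContinuousLinearMap.opNorm_le_bound _ (norm_nonneg _) fun v => ?_
    let w : PiLp 2 (fun _ : Fin (m + n) => H) := WithLp.toLp 2 (Fin.append 0 (fun i => v i))
    have h1 := hv w
    have h2 := key w
    have h3 := (opMatrix (m + n) (blockDiag x y)).le_opNorm w
    have e1 : (WithLp.toLp 2 fun i => w (Fin.castAdd n i) : PiLp 2 (fun _ : Fin m => H)) = 0 := by
      ext i; simp [w]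
    have e2 : (WithLp.toLp 2 fun i => w (Fin.natAdd m i) : PiLp 2 (fun _ : Fin n => H)) = v := by
      ext i; simp [w]
    rw [e1, e2] at h1 h2
    simp only [map_zero, norm_zero, ne_eq, OfNat.ofNat_ne_zero, not_false_eq_true, zero_pow,
      zero_add] at h1 h2
    rw [sq_eq_sq₀ (norm_nonneg _) (norm_nonneg _)] at h1 h2
    rwa [h1, h2] at h3

/-- The operator space structure of `L(H)`: the norm on `M_n(L(H))` is the operator norm on the
Hilbert space `Hⁿ`. -/
instance boundedOperatorSpace : OperatorSpace 𝕜 (H →L[𝕜] H) where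
  mnorm n := (normSeminorm 𝕜 _).comp (opMatrix n)
  mnorm_one x := by
    show ‖opMatrix (𝕜 := 𝕜) (H := H) 1 x‖ = _
    refine le_antisymm ?_ ?_
    · refine ContinuousLinearMap.opNorm_le_bound _ (norm_nonneg _) fun v => ?_
      have h := (x 0 0).le_opNorm (v 0)
      simpa [PiLp.norm_eq_of_L2, opMatrix_apply] using h
    · refine ContinuousLinearMap.opNorm_le_bound _ (norm_nonneg _) fun v => ?_
      have h := (opMatrix 1 x).le_opNorm (WithLp.toLp 2 fun _ => v)
      simpa [PiLp.norm_eq_of_L2, opMatrix_apply] using h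
  mnorm_scalarConj_le {m n} α x β := by
    show ‖opMatrix (𝕜 := 𝕜) (H := H) m _‖ ≤ ‖α‖ * ‖opMatrix (𝕜 := 𝕜) (H := H) n x‖ * ‖β‖
    rw [opMatrix_scalarConj, mul_assoc]
    refine (ContinuousLinearMap.opNorm_comp_le _ _).trans ?_
    refine mul_le_mul (norm_scalarAmp_le α) ?_ (norm_nonneg _) (norm_nonneg _)
    refine (ContinuousLinearMap.opNorm_comp_le _ _).trans ?_
    exact mul_le_mul_of_nonneg_left (norm_scalarAmp_le β) (norm_nonneg _)
  mnorm_blockDiag x y := norm_opMatrix_blockDiag x y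

end BoundedOperators

/-! ### Function algebras as operator algebras -/

noncomputable section FunctionAlgebras

open scoped Matrix.Norms.L2Operator

variable {𝕜 : Type*} [RCLike 𝕜]

theorem scalarMatrix_norm_blockDiag {m n : ℕ} (x : Matrix (Fin m) (Fin m) 𝕜)
    (y : Matrix (Fin n) (Fin n) 𝕜) : ‖blockDiag x y‖ = max ‖x‖ ‖y‖ := by
  have conv : ∀ {k : ℕ} (z : Matrix (Fin k) (Fin k) 𝕜),
      ‖z‖ = ‖opMatrix (𝕜 := 𝕜) (H := 𝕜) k
        (z.map fun c => c • ContinuousLinearMap.id 𝕜 𝕜)‖ := fun {k} z => by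
    refine le_antisymm ?_ ?_
    · rw [Matrix.cstar_norm_def]
      refine ContinuousLinearMap.opNorm_le_bound _ (norm_nonneg _) fun v => ?_
      refine le_of_eq_of_le ?_ (ContinuousLinearMap.le_opNorm _ v)
      congr 1
      ext i
      rw [opMatrix_apply]
      simp [Matrix.mulVec, dotProduct]
    · refine ContinuousLinearMap.opNorm_le_bound _ (norm_nonneg _) fun v => ?_
      refine le_of_eq_of_le ?_ (Matrix.l2_opNorm_mulVec z v)
      congr 1
      ext i
      rw [opMatrix_apply]
      simp [Matrix.mulVec, dotProduct]
  rw [conv, conv x, conv y, ← norm_opMatrix_blockDiag]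
  congr 2
  ext i j : 1
  refine Fin.addCases (fun i => ?_) (fun i => ?_) i <;>
    refine Fin.addCases (fun j => ?_) (fun j => ?_) j <;> simp [blockDiag]

variable {X : Type*} [TopologicalSpace X] [CompactSpace X]

/-- The identification `M_n(C(X)) ≅ C(X, M_n)`. -/
def funMatrix (n : ℕ) : Matrix (Fin n) (Fin n) C(X, 𝕜) →ₗ[𝕜] C(X, Matrix (Fin n) (Fin n) 𝕜) where
  toFun F := ⟨fun t => F.map fun f => f t, continuous_matrix fun i j => (F i j).continuous⟩
  map_add' F G := by ext; simp
  map_smul' c F := by ext; simp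

/-- The operator algebra structure that a unital subalgebra of `C(X)` inherits from the
`C*`-algebra `C(X)`: the norm on `M_n(C(X)) = C(X, M_n)` is the supremum over `X` of the operator
norms of the matrices `[f i j (t)]`. -/
instance functionAlgebra (S : Subalgebra 𝕜 C(X, 𝕜)) : OperatorAlgebra 𝕜 S where
  mnorm n := (normSeminorm 𝕜 _).comp (funMatrix n ∘ₗ S.val.toLinearMap.mapMatrix)
  mnorm_one x := by
    have h1 : ∀ M : Matrix (Fin 1) (Fin 1) 𝕜, ‖M‖ = ‖M 0 0‖ := fun M => by
      have h2 : M = Matrix.diagonal fun _ => M 0 0 := by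
        ext i j; fin_cases i; fin_cases j; simp
      rw [h2, Matrix.l2_opNorm_diagonal]
      simp
    refine le_antisymm ?_ ?_
    · refine (ContinuousMap.norm_le _ (norm_nonneg _)).2 fun t => ?_
      rw [h1]
      exact ContinuousMap.norm_coe_le_norm (x 0 0 : C(X, 𝕜)) t
    · refine (ContinuousMap.norm_le (x 0 0 : C(X, 𝕜)) (apply_nonneg _ _)).2 fun t => ?_
      refine le_of_eq_of_le ?_ (ContinuousMap.norm_coe_le_norm _ t)
      rw [h1]
      rfl
  mnorm_scalarConj_le {m n} α x β := by
    refine (ContinuousMap.norm_le _ (mul_nonneg (mul_nonneg (norm_nonneg _)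
      (apply_nonneg _ _)) (norm_nonneg _))).2 fun t => ?_
    let y : Matrix (Fin n) (Fin n) 𝕜 := x.map fun f => (f : C(X, 𝕜)) t
    have hy : ‖y‖ ≤ ((normSeminorm 𝕜 _).comp
        (funMatrix n ∘ₗ S.val.toLinearMap.mapMatrix)) x :=
      ContinuousMap.norm_coe_le_norm (funMatrix n (S.val.toLinearMap.mapMatrix x)) t
    have he : funMatrix m (S.val.toLinearMap.mapMatrix (scalarConj α x β)) t = α * y * β := by
      ext i j
      simp only [funMatrix, scalarConj, Matrix.mul_apply, Finset.sum_mul, y, LinearMap.coe_mk,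
        AddHom.coe_mk, ContinuousMap.coe_mk, Matrix.map_apply, LinearMap.mapMatrix_apply,
        Matrix.of_apply, map_sum, map_smul, ContinuousMap.sum_apply, ContinuousMap.smul_apply]
      rw [Finset.sum_comm]
      refine Finset.sum_congr rfl fun l _ => Finset.sum_congr rfl fun k _ => ?_
      simp only [smul_eq_mul, AlgHom.toLinearMap_apply, Subalgebra.coe_val]
      ring
    refine le_of_eq_of_le (congrArg norm he) ?_
    refine (Matrix.l2_opNorm_mul _ _).trans ?_
    gcongr
    refine (Matrix.l2_opNorm_mul _ _).trans ?_
    gcongr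
  mnorm_blockDiag {m n} x y := by
    have he : ∀ t, funMatrix (m + n) (S.val.toLinearMap.mapMatrix (blockDiag x y)) t =
        blockDiag (funMatrix m (S.val.toLinearMap.mapMatrix x) t)
          (funMatrix n (S.val.toLinearMap.mapMatrix y) t) := fun t => by
      ext i j
      refine Fin.addCases (fun i => ?_) (fun i => ?_) i <;>
        refine Fin.addCases (fun j => ?_) (fun j => ?_) j <;> simp [blockDiag, funMatrix]
    refine le_antisymm ?_ (max_le ?_ ?_)
    · refine (ContinuousMap.norm_le _ (le_max_of_le_left (apply_nonneg _ _))).2 fun t => ?_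
      refine le_of_eq_of_le (congrArg norm (he t)) ?_
      rw [scalarMatrix_norm_blockDiag]
      exact max_le_max (ContinuousMap.norm_coe_le_norm _ t) (ContinuousMap.norm_coe_le_norm _ t)
    · refine (ContinuousMap.norm_le _ (apply_nonneg _ _)).2 fun t => ?_
      refine le_trans ?_ (ContinuousMap.norm_coe_le_norm _ t)
      refine le_of_le_of_eq ?_ (congrArg norm (he t)).symm
      rw [scalarMatrix_norm_blockDiag]
      exact le_max_left _ _
    · refine (ContinuousMap.norm_le _ (apply_nonneg _ _)).2 fun t => ?_
      refine le_trans ?_ (ContinuousMap.norm_coe_le_norm _ t)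
      refine le_of_le_of_eq ?_ (congrArg norm (he t)).symm
      rw [scalarMatrix_norm_blockDiag]
      exact le_max_right _ _
  norm_one_le := by
    refine (ContinuousMap.norm_le (1 : C(X, 𝕜)) zero_le_one).2 fun t => ?_
    simp
  mnorm_mul_le {n} x y := by
    refine (ContinuousMap.norm_le _ (mul_nonneg (apply_nonneg _ _) (apply_nonneg _ _))).2
      fun t => ?_
    have he : funMatrix n (S.val.toLinearMap.mapMatrix (x * y)) t =
        funMatrix n (S.val.toLinearMap.mapMatrix x) t *
          funMatrix n (S.val.toLinearMap.mapMatrix y) t := by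
      ext i j
      simp [funMatrix, Matrix.mul_apply]
    refine le_of_eq_of_le (congrArg norm he) ?_
    refine (Matrix.l2_opNorm_mul _ _).trans ?_
    exact mul_le_mul (ContinuousMap.norm_coe_le_norm _ t) (ContinuousMap.norm_coe_le_norm _ t)
      (norm_nonneg _) (apply_nonneg _ _)

/-- The algebra `P(𝔻ⁿ)` of complex polynomial functions in `n` variables, as a subalgebra of
`C(𝕋ⁿ)`. -/
def polydiscAlgebra (n : ℕ) : Subalgebra ℂ C(Fin n → Circle, ℂ) :=
  (MvPolynomial.aeval (R := ℂ) fun i : Fin n =>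
    (⟨fun z => (z i : ℂ), by fun_prop⟩ : C(Fin n → Circle, ℂ))).range

end FunctionAlgebras

/-! ### The categories and the forgetful functors -/

/-- Unital normed algebras: the norm is submultiplicative, and `‖1‖ = 1` unless the algebra is the
zero algebra, which is allowed. -/
structure NAlg (𝕜 : Type) [RCLike 𝕜] : Type (u + 1) where
  carrier : Type u
  [normedRing : NormedRing carrier]
  [normedAlgebra : NormedAlgebra 𝕜 carrier]
  norm_one_le : ‖(1 : carrier)‖ ≤ 1

/-- Unital operator algebras. -/
structure OAlg (𝕜 : Type) [RCLike 𝕜] : Type (u + 1) where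
  carrier : Type u
  [normedRing : NormedRing carrier]
  [normedAlgebra : NormedAlgebra 𝕜 carrier]
  [operatorAlgebra : OperatorAlgebra 𝕜 carrier]

attribute [instance] NAlg.normedRing NAlg.normedAlgebra
attribute [instance] OAlg.normedRing OAlg.normedAlgebra OAlg.operatorAlgebra

namespace NAlg

instance (𝕜 : Type) [RCLike 𝕜] : CoeSort (NAlg.{u} 𝕜) (Type u) := ⟨NAlg.carrier⟩

/-- Morphisms of normed algebras: contractive unital algebra homomorphisms. -/
@[ext]
structure Hom {𝕜 : Type} [RCLike 𝕜] (A B : NAlg.{u} 𝕜) where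
  toAlgHom : A →ₐ[𝕜] B
  contractive : ∀ a, ‖toAlgHom a‖ ≤ ‖a‖

instance (𝕜 : Type) [RCLike 𝕜] : Category (NAlg.{u} 𝕜) where
  Hom A B := Hom A B
  id A := ⟨AlgHom.id 𝕜 A, fun _ => le_rfl⟩
  comp f g := ⟨g.toAlgHom.comp f.toAlgHom, fun a => (g.contractive _).trans (f.contractive a)⟩

/-- The property of being complete, that is, a unital Banach algebra. -/
def isComplete (𝕜 : Type) [RCLike 𝕜] : ObjectProperty (NAlg.{u} 𝕜) := fun A => CompleteSpace A

end NAlg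

namespace OAlg

instance (𝕜 : Type) [RCLike 𝕜] : CoeSort (OAlg.{u} 𝕜) (Type u) := ⟨OAlg.carrier⟩

/-- Morphisms of operator algebras: completely contractive unital algebra homomorphisms. -/
@[ext]
structure Hom {𝕜 : Type} [RCLike 𝕜] (A B : OAlg.{u} 𝕜) where
  toAlgHom : A →ₐ[𝕜] B
  completelyContractive : IsCompletelyContractive 𝕜 toAlgHom.toLinearMap

instance (𝕜 : Type) [RCLike 𝕜] : Category (OAlg.{u} 𝕜) where
  Hom A B := Hom A B
  id A := ⟨AlgHom.id 𝕜 A, fun _ _ => le_rfl⟩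
  comp f g := ⟨g.toAlgHom.comp f.toAlgHom, fun n x =>
    (g.completelyContractive n (x.map f.toAlgHom)).trans (f.completelyContractive n x)⟩

/-- The property of being complete. -/
def isComplete (𝕜 : Type) [RCLike 𝕜] : ObjectProperty (OAlg.{u} 𝕜) := fun A => CompleteSpace A

theorem Hom.contractive {𝕜 : Type} [RCLike 𝕜] {A B : OAlg.{u} 𝕜} (f : Hom A B) (a : A) :
    ‖f.toAlgHom a‖ ≤ ‖a‖ := by
  have h := f.completelyContractive 1 (Matrix.of fun _ _ => a)
  rw [OperatorSpace.mnorm_one, OperatorSpace.mnorm_one] at h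
  exact h

/-- The forgetful functor from operator algebras to normed algebras, which remembers only the
norm on the algebra itself. -/
def forget (𝕜 : Type) [RCLike 𝕜] : OAlg.{u} 𝕜 ⥤ NAlg.{u} 𝕜 where
  obj A := ⟨A, OperatorAlgebra.norm_one_le (𝕜 := 𝕜)⟩
  map f := ⟨Hom.toAlgHom f, Hom.contractive f⟩

end OAlg

/-- The category of unital Banach algebras. -/
abbrev NAlgHat (𝕜 : Type) [RCLike 𝕜] : Type (u + 1) := (NAlg.isComplete.{u} 𝕜).FullSubcategory

/-- The category of complete unital operator algebras. -/
abbrev OAlgHat (𝕜 : Type) [RCLike 𝕜] : Type (u + 1) := (OAlg.isComplete.{u} 𝕜).FullSubcategory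

/-- The forgetful functor from complete operator algebras to Banach algebras. -/
def OAlgHat.forget (𝕜 : Type) [RCLike 𝕜] : OAlgHat.{u} 𝕜 ⥤ NAlgHat.{u} 𝕜 :=
  (NAlg.isComplete 𝕜).lift ((OAlg.isComplete 𝕜).ι ⋙ OAlg.forget 𝕜) fun A => A.property

/-- The underlying algebra homomorphism of a morphism of operator algebras. -/
abbrev OAlg.algHom {𝕜 : Type} [RCLike 𝕜] {A B : OAlg.{u} 𝕜} (f : A ⟶ B) : A →ₐ[𝕜] B :=
  Hom.toAlgHom f

/-! ### Monadicity -/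

/-- A right adjoint functor is pre-monadic if its comparison functor to the Eilenberg-Moore
category is fully faithful. -/
def IsPreMonadic {C D : Type*} [Category C] [Category D] (U : D ⥤ C) : Prop :=
  ∃ (F : C ⥤ D) (adj : F ⊣ U), (Monad.comparison adj).Full ∧ (Monad.comparison adj).Faithful

/-- A right adjoint functor is monadic if its comparison functor to the Eilenberg-Moore category
is an equivalence. -/
def IsMonadic {C D : Type*} [Category C] [Category D] (U : D ⥤ C) : Prop :=
  ∃ (F : C ⥤ D) (adj : F ⊣ U), (Monad.comparison adj).IsEquivalence

/-! The forgetful functor discards the matrix norms, so it inverts a non-isomorphism as soon as one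
normed algebra carries two comparable but different operator algebra structures. Among all families
of matrix seminorms on a normed algebra `N` that satisfy the axioms and are dominated by the norm
there is a largest one, the pointwise supremum `maximal`; it is finite because a matrix seminorm is
bounded by the seminorms of the entries. Dividing out its kernel, and completing in the complete
case, gives the free operator algebra on `N`: the matrix norms pulled back along a contractive
homomorphism form one of the competing families, so the induced homomorphism is completely
contractive.

If `A` is already an operator algebra, its own structure takes part in the supremum, so at level one
`maximal` is exactly the norm. Thus `A.max` has the same underlying normed algebra, and the identity
`A.max ⟶ A` is, up to isomorphism, the counit at `A`. A contractive representation that is not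
completely contractive pulls back to a competitor exceeding the norms of `A` on some matrix, so this
identity is not an isomorphism. Being monic, it is then no regular epimorphism; and the comparison
functor makes it invertible, hence is not full (`counit_of_universal`).

For the polydisc, Parrott's construction sends `p` to `p(0)` plus a nilpotent corner `∑ ∂ᵢp(0) Uᵢ`.
This is contractive for any contractions `Uᵢ` (`norm_cornerRep_oneJet_le`), but not completely
contractive for three suitable unitaries. That algebra is complex and incomplete, so non-monadicity
over both fields rests on another example: the square zero extension of `𝕜` by a two-dimensional
column space, on which transposition is contractive but increases a matrix norm from at most `1` to
more than `1`. -/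

/-! ### Operator algebra seminorms -/

noncomputable section OperatorAlgebraSeminorms

open scoped Matrix.Norms.L2Operator

/-- A family of seminorms on the matrix algebras `M_n(N)` over an algebra `N` that satisfies the
axioms of an operator algebra, except that it need not separate points. -/
structure OperatorAlgebraSeminorm (𝕜 : Type*) [RCLike 𝕜] (N : Type*) [Ring N] [Algebra 𝕜 N] where
  seminorm (n : ℕ) : Seminorm 𝕜 (Matrix (Fin n) (Fin n) N)
  scalarConj_le {m n : ℕ} (α : Matrix (Fin m) (Fin n) 𝕜) (x : Matrix (Fin n) (Fin n) N)
    (β : Matrix (Fin n) (Fin m) 𝕜) : seminorm m (scalarConj α x β) ≤ ‖α‖ * seminorm n x * ‖β‖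
  blockDiag_eq {m n : ℕ} (x : Matrix (Fin m) (Fin m) N) (y : Matrix (Fin n) (Fin n) N) :
    seminorm (m + n) (blockDiag x y) = max (seminorm m x) (seminorm n y)
  mul_le {n : ℕ} (x y : Matrix (Fin n) (Fin n) N) :
    seminorm n (x * y) ≤ seminorm n x * seminorm n y
  one_le : seminorm 1 (Matrix.of fun _ _ => 1) ≤ 1

theorem map_scalarConj {𝕜 E F : Type*} [Semiring 𝕜] [AddCommMonoid E] [Module 𝕜 E]
    [AddCommMonoid F] [Module 𝕜 F] (f : E →ₗ[𝕜] F) {m n p q : ℕ}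
    (α : Matrix (Fin p) (Fin m) 𝕜) (x : Matrix (Fin m) (Fin n) E) (β : Matrix (Fin n) (Fin q) 𝕜) :
    (scalarConj α x β).map f = scalarConj α (x.map f) β := by
  ext i j
  simp [scalarConj]

theorem map_blockDiag {E F : Type*} [Zero E] [Zero F] (f : E → F) (hf : f 0 = 0) {m n : ℕ}
    (x : Matrix (Fin m) (Fin m) E) (y : Matrix (Fin n) (Fin n) E) :
    (blockDiag x y).map f = blockDiag (x.map f) (y.map f) := by
  ext i j
  refine Fin.addCases (fun i => ?_) (fun i => ?_) i <;>
    refine Fin.addCases (fun j => ?_) (fun j => ?_) j <;> simp [blockDiag, hf]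

namespace OperatorAlgebraSeminorm

variable {𝕜 : Type*} [RCLike 𝕜] {N : Type*} [Ring N] [Algebra 𝕜 N]
  {M : Type*} [Ring M] [Algebra 𝕜 M]

/-- The seminorms of an operator algebra. -/
def ofOperatorAlgebra (𝕜 : Type*) [RCLike 𝕜] (A : Type*) [NormedRing A] [NormedAlgebra 𝕜 A]
    [OperatorAlgebra 𝕜 A] : OperatorAlgebraSeminorm 𝕜 A where
  seminorm := OperatorSpace.mnorm
  scalarConj_le := OperatorSpace.mnorm_scalarConj_le
  blockDiag_eq := OperatorSpace.mnorm_blockDiag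
  mul_le := OperatorAlgebra.mnorm_mul_le
  one_le := by
    rw [OperatorSpace.mnorm_one]
    exact OperatorAlgebra.norm_one_le (𝕜 := 𝕜)

theorem opMatrix_mul {H : Type*} [NormedAddCommGroup H] [InnerProductSpace 𝕜 H] {n : ℕ}
    (x y : Matrix (Fin n) (Fin n) (H →L[𝕜] H)) :
    opMatrix n (x * y) = opMatrix n x ∘L opMatrix n y := by
  ext v i
  simp only [opMatrix_apply, ContinuousLinearMap.comp_apply, Matrix.mul_apply, sum_apply, map_sum,
    mul_apply_eq_comp]
  exact Finset.sum_comm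

/-- The seminorms of the algebra of bounded operators on a Hilbert space. -/
def ofBoundedOperators (𝕜 : Type*) [RCLike 𝕜] (H : Type*) [NormedAddCommGroup H]
    [InnerProductSpace 𝕜 H] : OperatorAlgebraSeminorm 𝕜 (H →L[𝕜] H) where
  seminorm := OperatorSpace.mnorm
  scalarConj_le := OperatorSpace.mnorm_scalarConj_le
  blockDiag_eq := OperatorSpace.mnorm_blockDiag
  mul_le {n} x y := by
    change ‖opMatrix (𝕜 := 𝕜) (H := H) n _‖ ≤ ‖opMatrix n x‖ * ‖opMatrix n y‖
    rw [opMatrix_mul]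
    exact ContinuousLinearMap.opNorm_comp_le _ _
  one_le := by
    rw [OperatorSpace.mnorm_one]
    exact ContinuousLinearMap.norm_id_le (𝕜 := 𝕜) (E := H)

/-- The pullback of seminorms along an algebra homomorphism. -/
def comap (p : OperatorAlgebraSeminorm 𝕜 M) (f : N →ₐ[𝕜] M) : OperatorAlgebraSeminorm 𝕜 N where
  seminorm n := (p.seminorm n).comp f.toLinearMap.mapMatrix
  scalarConj_le α x β := by
    have h := p.scalarConj_le α (x.map f) β
    have e := map_scalarConj f.toLinearMap α x β
    exact le_of_eq_of_le (congrArg (p.seminorm _) e) h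
  blockDiag_eq x y := by
    have e := map_blockDiag f (map_zero f) x y
    exact (congrArg (p.seminorm _) e).trans (p.blockDiag_eq _ _)
  mul_le x y := by
    have e : (x * y).map f = x.map f * y.map f := Matrix.map_mul
    exact le_of_eq_of_le (congrArg (p.seminorm _) e) (p.mul_le _ _)
  one_le := by
    refine le_of_eq_of_le (congrArg (p.seminorm 1) ?_) p.one_le
    ext i j
    exact map_one f

variable (𝕜) in
/-- A constant that bounds a matrix seminorm by the seminorms of the entries. -/
def entryConst (n : ℕ) : ℝ :=
  ∑ i : Fin n, ∑ j : Fin n, ‖(Matrix.of fun k _ => if k = i then 1 else 0 :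
    Matrix (Fin n) (Fin 1) 𝕜)‖ * ‖(Matrix.of fun _ l => if l = j then 1 else 0 :
    Matrix (Fin 1) (Fin n) 𝕜)‖

variable (𝕜) in
theorem entryConst_nonneg (n : ℕ) : 0 ≤ entryConst 𝕜 n := by
  unfold entryConst
  positivity

/-- Decompose `x` as `∑ eᵢ xᵢⱼ eⱼᵀ` and apply Ruan's first axiom to each term. The crude constant
suffices: only finiteness of suprema and Lipschitz continuity in the entries depend on it. -/
theorem seminorm_le_of_entries (p : OperatorAlgebraSeminorm 𝕜 N) {n : ℕ}
    (x : Matrix (Fin n) (Fin n) N) (C : ℝ)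
    (hC : ∀ i j, p.seminorm 1 (Matrix.of fun _ _ => x i j) ≤ C) :
    p.seminorm n x ≤ entryConst 𝕜 n * C := by
  have hx : x = ∑ i : Fin n, ∑ j : Fin n, scalarConj
      (Matrix.of fun k _ => if k = i then 1 else 0 : Matrix (Fin n) (Fin 1) 𝕜)
      (Matrix.of fun _ _ => x i j : Matrix (Fin 1) (Fin 1) N)
      (Matrix.of fun _ l => if l = j then 1 else 0 : Matrix (Fin 1) (Fin n) 𝕜) := by
    ext k l
    simp [scalarConj, Matrix.sum_apply, ite_smul]
  conv_lhs => rw [hx]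
  rw [entryConst, Finset.sum_mul]
  refine (Finset.le_sum_of_subadditive _ (map_zero _).le (map_add_le_add _) _ _).trans
    (Finset.sum_le_sum fun i _ => ?_)
  rw [Finset.sum_mul]
  refine (Finset.le_sum_of_subadditive _ (map_zero _).le (map_add_le_add _) _ _).trans
    (Finset.sum_le_sum fun j _ => ?_)
  refine (p.scalarConj_le _ _ _).trans ?_
  rw [mul_right_comm]
  exact mul_le_mul_of_nonneg_left (hC i j) (by positivity)

/-- The operator algebra structure on a normed algebra given by seminorms that are compatible with
the norm. -/
@[reducible]
def toOperatorAlgebra {A : Type*} [NormedRing A] [NormedAlgebra 𝕜 A]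
    (p : OperatorAlgebraSeminorm 𝕜 A)
    (hp : ∀ a, p.seminorm 1 (Matrix.of fun _ _ => a) = ‖a‖) : OperatorAlgebra 𝕜 A where
  mnorm := p.seminorm
  mnorm_one x := by
    rw [← hp]
    congr 1
    ext i j
    fin_cases i; fin_cases j; rfl
  mnorm_scalarConj_le := p.scalarConj_le
  mnorm_blockDiag := p.blockDiag_eq
  mnorm_mul_le := p.mul_le
  norm_one_le := by
    rw [← hp]
    exact p.one_le

/-! ### The largest operator algebra seminorms below a norm -/

section Maximal

variable {N : Type*} [NormedRing N] [NormedAlgebra 𝕜 N]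

/-- Seminorms that are dominated by a given norm on the algebra itself. -/
def IsContractive (p : OperatorAlgebraSeminorm 𝕜 N) : Prop :=
  ∀ a, p.seminorm 1 (Matrix.of fun _ _ => a) ≤ ‖a‖

theorem bddAbove_range (n : ℕ) (x : Matrix (Fin n) (Fin n) N) :
    BddAbove (Set.range fun p : {p : OperatorAlgebraSeminorm 𝕜 N // p.IsContractive} =>
      p.1.seminorm n x) := by
  refine ⟨entryConst 𝕜 n * ∑ i, ∑ j, ‖x i j‖, ?_⟩
  rintro _ ⟨p, rfl⟩
  refine p.1.seminorm_le_of_entries x _ fun i j => (p.2 _).trans ?_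
  exact (Finset.single_le_sum (f := fun j => ‖x i j‖) (fun _ _ => norm_nonneg _)
    (Finset.mem_univ j)).trans (Finset.single_le_sum (f := fun i => ∑ j, ‖x i j‖)
      (fun _ _ => Finset.sum_nonneg fun _ _ => norm_nonneg _) (Finset.mem_univ i))

/-- The zero family qualifies because separation of points is not demanded; nonemptiness is what
`ciSup_le` needs. -/
instance : Nonempty {p : OperatorAlgebraSeminorm 𝕜 N // p.IsContractive} :=
  ⟨⟨{ seminorm := fun _ => 0
      scalarConj_le := by simp
      blockDiag_eq := by simp
      mul_le := by simp
      one_le := by simp }, fun a => norm_nonneg a⟩⟩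

variable (𝕜 N) in
/-- The largest family of operator algebra seminorms that is dominated by a given norm. -/
def maximal (h1 : ‖(1 : N)‖ ≤ 1) : OperatorAlgebraSeminorm 𝕜 N where
  seminorm n := Seminorm.of
    (fun x => ⨆ p : {p : OperatorAlgebraSeminorm 𝕜 N // p.IsContractive}, p.1.seminorm n x)
    (fun x y => ciSup_le fun p => (map_add_le_add _ _ _).trans
      (add_le_add (le_ciSup (bddAbove_range n x) p) (le_ciSup (bddAbove_range n y) p)))
    (fun c x => by
      simp_rw [map_smul_eq_mul]
      exact (Real.mul_iSup_of_nonneg (norm_nonneg c) _).symm)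
  scalarConj_le {m n} α x β := by
    refine ciSup_le fun p => (p.1.scalarConj_le α x β).trans ?_
    gcongr
    exact le_ciSup (bddAbove_range n x) p
  blockDiag_eq {m n} x y := by
    refine le_antisymm (ciSup_le fun p => ?_) (max_le (ciSup_le fun p => ?_)
      (ciSup_le fun p => ?_))
    · rw [p.1.blockDiag_eq]
      exact max_le_max (le_ciSup (bddAbove_range m x) p) (le_ciSup (bddAbove_range n y) p)
    · refine le_trans ?_ (le_ciSup (bddAbove_range _ _) p)
      exact (le_max_left _ _).trans (p.1.blockDiag_eq x y).ge
    · refine le_trans ?_ (le_ciSup (bddAbove_range _ _) p)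
      exact (le_max_right _ _).trans (p.1.blockDiag_eq x y).ge
  mul_le {n} x y := ciSup_le fun p => (p.1.mul_le x y).trans
    (mul_le_mul (le_ciSup (bddAbove_range n x) p) (le_ciSup (bddAbove_range n y) p)
      (apply_nonneg _ _) ((apply_nonneg _ _).trans (le_ciSup (bddAbove_range n x) p)))
  one_le := ciSup_le fun p => (p.2 _).trans h1

theorem le_maximal (h1 : ‖(1 : N)‖ ≤ 1) (p : OperatorAlgebraSeminorm 𝕜 N) (hp : p.IsContractive)
    {n : ℕ} (x : Matrix (Fin n) (Fin n) N) : p.seminorm n x ≤ (maximal 𝕜 N h1).seminorm n x :=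
  le_ciSup (bddAbove_range n x) ⟨p, hp⟩

theorem maximal_isContractive (h1 : ‖(1 : N)‖ ≤ 1) : (maximal 𝕜 N h1).IsContractive :=
  fun a => ciSup_le fun p => p.2 a

end Maximal

/-! ### Extending seminorms along dense homomorphisms -/

section Extension

variable {D : Type*} [NormedRing D] [NormedAlgebra 𝕜 D]

/-- By the entry bound, the seminorm is Lipschitz for the distance between the images of the entries
in `D`. It therefore descends to the image and extends to all matrices as a Lipschitz real function.
Density is not needed yet; it enters when the axioms are transferred. -/
theorem exists_continuous_extension (p : OperatorAlgebraSeminorm 𝕜 N) (e : N →ₐ[𝕜] D)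
    (he : ∀ a, p.seminorm 1 (Matrix.of fun _ _ => a) = ‖e a‖) (n : ℕ) :
    ∃ E : (Fin n → Fin n → D) → ℝ, Continuous E ∧
      ∀ x : Matrix (Fin n) (Fin n) N, E (fun i j => e (x i j)) = p.seminorm n x := by
  have key : ∀ x y : Matrix (Fin n) (Fin n) N, p.seminorm n x ≤ p.seminorm n y +
      entryConst 𝕜 n * dist (fun i j => e (x i j)) (fun i j => e (y i j)) := fun x y => by
    have h1 : p.seminorm n x ≤ p.seminorm n y + p.seminorm n (x - y) := by
      conv_lhs => rw [← add_sub_cancel y x]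
      exact map_add_le_add _ _ _
    refine h1.trans (add_le_add_right (p.seminorm_le_of_entries _ _ fun i j => ?_) _)
    rw [he, Matrix.sub_apply, map_sub, ← dist_eq_norm]
    exact (dist_le_pi_dist (fun j => e (x i j)) (fun j => e (y i j)) j).trans
      (dist_le_pi_dist (fun i j => e (x i j)) (fun i j => e (y i j)) i)
  let φ : Matrix (Fin n) (Fin n) N → (Fin n → Fin n → D) := fun x i j => e (x i j)
  -- The choice of preimage is immaterial: by `key`, matrices with the same image have the same
  -- seminorm.
  let f : (Fin n → Fin n → D) → ℝ := fun y => p.seminorm n (Function.invFun φ y)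
  have hinv : ∀ x, φ (Function.invFun φ (φ x)) = φ x := fun x =>
    Function.invFun_eq ⟨x, rfl⟩
  have hf : LipschitzOnWith ⟨entryConst 𝕜 n, entryConst_nonneg 𝕜 n⟩ f (Set.range φ) := by
    refine LipschitzOnWith.of_le_add_mul _ ?_
    rintro _ ⟨x, rfl⟩ _ ⟨y, rfl⟩
    have h := key (Function.invFun φ (φ x)) (Function.invFun φ (φ y))
    change _ ≤ _ + _ * dist (φ _) (φ _) at h
    rw [hinv, hinv] at h
    exact h
  obtain ⟨E, hE, hEf⟩ := hf.extend_real
  refine ⟨E, hE.continuous, fun x => (hEf ⟨x, rfl⟩).symm.trans ?_⟩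
  have h1 := key (Function.invFun φ (φ x)) x
  have h2 := key x (Function.invFun φ (φ x))
  change _ ≤ _ + _ * dist (φ _) (φ _) at h1 h2
  rw [hinv, dist_self, mul_zero, add_zero] at h1 h2
  exact le_antisymm h1 h2

theorem denseRange_entries {N : Type*} {e : N → D} (he : DenseRange e) (n : ℕ) :
    DenseRange fun (x : Matrix (Fin n) (Fin n) N) (i j : Fin n) => e (x i j) :=
  DenseRange.piMap fun _ => DenseRange.piMap fun _ => he

/-- Seminorms extend along dense homomorphisms that are isometric. -/
theorem exists_extension (p : OperatorAlgebraSeminorm 𝕜 N) (e : N →ₐ[𝕜] D)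
    (he : ∀ a, p.seminorm 1 (Matrix.of fun _ _ => a) = ‖e a‖) (hd : DenseRange e) :
    ∃ q : OperatorAlgebraSeminorm 𝕜 D,
      (∀ n, Continuous fun y : Fin n → Fin n → D => q.seminorm n (Matrix.of y)) ∧
      (∀ (n : ℕ) (x : Matrix (Fin n) (Fin n) N), q.seminorm n (x.map e) = p.seminorm n x) := by
  choose E hE hEx using p.exists_continuous_extension e he
  have hEx' : ∀ (n : ℕ) (x : Matrix (Fin n) (Fin n) N), E n (x.map e) = p.seminorm n x := hEx
  have dense := denseRange_entries hd
  refine ⟨{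
    seminorm := fun n => Seminorm.of (fun y => E n y) (fun x y => ?_) (fun c x => ?_)
    scalarConj_le := fun {m n} α x β => ?_
    blockDiag_eq := fun {m n} x y => ?_
    mul_le := fun {n} x y => ?_
    one_le := ?_ }, hE, hEx'⟩
  -- Each axiom is a closed condition on the entries, hence need only be checked on images of
  -- matrices over `N`.
  · refine (dense n).induction_on₂ (p := fun x y => E n (x + y) ≤ E n x + E n y)
      (isClosed_le ((hE n).comp (by fun_prop)) (by fun_prop)) (fun x y => ?_) x y
    have h := map_add_le_add (p.seminorm n) x y
    rw [← hEx' n, ← hEx' n, ← hEx' n, Matrix.map_add _ (map_add e)] at h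
    exact h
  · refine (dense n).induction_on (p := fun x => E n (c • x) = ‖c‖ * E n x) x
      (isClosed_eq ((hE n).comp (by fun_prop)) (by fun_prop)) (fun x => ?_)
    have h := map_smul_eq_mul (p.seminorm n) c x
    rw [← hEx' n, ← hEx' n, Matrix.map_smul _ _ (fun a => map_smul e c a)] at h
    exact h
  · refine (dense n).induction_on (p := fun x => E m (scalarConj α x β) ≤ ‖α‖ * E n x * ‖β‖) x
      (isClosed_le ((hE m).comp ?_) (by fun_prop)) (fun x => ?_)
    · unfold scalarConj
      refine continuous_pi fun i => continuous_pi fun j => ?_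
      simp only [Matrix.of_apply]
      fun_prop
    · have h := p.scalarConj_le α x β
      rw [← hEx' m, ← hEx' n] at h
      have e1 := map_scalarConj e.toLinearMap α x β
      exact le_of_eq_of_le (congrArg (E m) e1.symm) h
  · have cont : Continuous fun z : (Fin m → Fin m → D) × (Fin n → Fin n → D) =>
        E (m + n) (blockDiag z.1 z.2) := by
      refine (hE _).comp (continuous_pi fun i => continuous_pi fun j => ?_)
      refine Fin.addCases (fun i => ?_) (fun i => ?_) i <;>
        refine Fin.addCases (fun j => ?_) (fun j => ?_) j <;> simp [blockDiag] <;> fun_prop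
    -- The two blocks have different sizes, so density is used in one variable at a time.
    refine (dense m).induction_on (p := fun x => E (m + n) (blockDiag x y) = max (E m x) (E n y)) x
      (isClosed_eq (cont.comp (Continuous.prodMk_left y)) (by fun_prop)) (fun x => ?_)
    refine (dense n).induction_on (p := fun y => E (m + n) (blockDiag (fun i j => e (x i j)) y) =
        max (E m fun i j => e (x i j)) (E n y)) y
      (isClosed_eq (cont.comp (Continuous.prodMk_right _)) (by fun_prop)) (fun y => ?_)
    have h := p.blockDiag_eq x y
    rw [← hEx' m, ← hEx' n, ← hEx', map_blockDiag _ (map_zero e)] at h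
    exact h
  · refine (dense n).induction_on₂ (p := fun x y =>
        E n ((x : Matrix (Fin n) (Fin n) D) * (y : Matrix (Fin n) (Fin n) D)) ≤ E n x * E n y)
      (isClosed_le ((hE n).comp ?_) (by fun_prop)) (fun x y => ?_) x y
    · refine continuous_pi fun i => continuous_pi fun j => ?_
      simp only [Matrix.mul_apply]
      fun_prop
    · have h := p.mul_le x y
      rw [← hEx' n, ← hEx' n, ← hEx' n, Matrix.map_mul] at h
      exact h
  · have h := p.one_le
    rw [← hEx' 1] at h
    refine le_of_eq_of_le (congrArg (E 1) ?_) h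
    ext i j
    exact (map_one e).symm

end Extension

end OperatorAlgebraSeminorm

end OperatorAlgebraSeminorms

/-! ### Right adjoints with a non-invertible counit -/

section Adjunctions

universe v₁ v₂ u₁ u₂

variable {C : Type u₁} {D : Type u₂} [Category.{v₁} C] [Category.{v₂} D] {U : D ⥤ C}

/-- A universal arrow is an initial object of the comma category under `X`, and such initial objects
assemble into a left adjoint. -/
theorem isRightAdjoint_of_universal_arrows (h : ∀ X : C, ∃ (Y : D) (i : X ⟶ U.obj Y),
    ∀ (Z : D) (g : X ⟶ U.obj Z), ∃! f : Y ⟶ Z, i ≫ U.map f = g) : U.IsRightAdjoint := by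
  have : ∀ X, Limits.HasInitial (StructuredArrow X U) := fun X => by
    obtain ⟨Y, i, hi⟩ := h X
    refine Limits.IsInitial.hasInitial (X := StructuredArrow.mk i)
      (Limits.IsInitial.ofUniqueHom (fun T => ?_) fun T m => ?_)
    · exact StructuredArrow.homMk (hi T.right T.hom).choose
        (hi T.right T.hom).choose_spec.1
    · ext
      exact (hi T.right T.hom).choose_spec.2 m.right (StructuredArrow.w m)
  exact isRightAdjointOfStructuredArrowInitials U


/-- If a monomorphism coequalizes a pair, the two members of the pair agree; the identity of `B`
then factors through `f`, so `f` is split mono as well as epi. -/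
theorem not_isRegularEpi_of_mono {A B : D} (f : B ⟶ A) [Mono f] (hf : ¬ IsIso f) :
    ¬ IsRegularEpi f := fun h => by
  have hw : IsRegularEpi.left f = IsRegularEpi.right f :=
    (cancel_mono f).1 (IsRegularEpi.w f)
  have h1 : f ≫ IsRegularEpi.desc f (𝟙 B) (by rw [hw]) = 𝟙 B := IsRegularEpi.fac f _ _
  have : IsSplitMono f := ⟨⟨⟨_, h1⟩⟩⟩
  exact hf (isIso_of_epi_of_isSplitMono f)

theorem not_isPreMonadic_of_comparison {A : D}
    (h : ∀ (F : C ⥤ D) (adj : F ⊣ U), ∃ B : D, ¬ Function.Surjective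
      fun f : A ⟶ B => (Monad.comparison adj).map f) : ¬ IsPreMonadic U := by
  rintro ⟨F, adj, hfull, -⟩
  obtain ⟨B, hB⟩ := h F adj
  exact hB (Monad.comparison adj).map_surjective

theorem IsMonadic.isPreMonadic (h : IsMonadic U) : IsPreMonadic U := by
  obtain ⟨F, adj, h⟩ := h
  exact ⟨F, adj, inferInstance, inferInstance⟩

variable [U.Faithful] {F : C ⥤ D} (adj : F ⊣ U)

/-- If the identity of `U A` lifts to a universal arrow `U A ⟶ U B`, then the counit at `A` is
identified with the corresponding morphism `B ⟶ A`. -/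
theorem exists_iso_hom_comp_eq_counit {A B : D} (f : B ⟶ A) [IsIso (U.map f)]
    (hf : ∀ (Z : D) (g : U.obj A ⟶ U.obj Z), ∃ k : B ⟶ Z, U.map k = U.map f ≫ g) :
    ∃ φ : F.obj (U.obj A) ≅ B, φ.hom ≫ f = adj.counit.app A := by
  -- The isomorphism is the transpose `t` of the inverse of `U.map f`, with inverse the lift `k` of
  -- the unit.
  obtain ⟨k, hk⟩ := hf _ (adj.unit.app (U.obj A))
  have ext : ∀ {Z : D} (s t : F.obj (U.obj A) ⟶ Z), adj.unit.app (U.obj A) ≫ U.map s =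
      adj.unit.app (U.obj A) ≫ U.map t → s = t := fun s t h =>
    (adj.homEquiv _ _).injective
      ((adj.homEquiv_unit ..).trans (h.trans (adj.homEquiv_unit ..).symm))
  obtain ⟨t, ht⟩ := (adj.homEquiv _ _).surjective (inv (U.map f))
  rw [adj.homEquiv_unit] at ht
  refine ⟨⟨t, k, ext _ _ ?_, U.map_injective ?_⟩, ext _ _ ?_⟩
  · rw [U.map_comp, reassoc_of% ht, hk]
    simp
  · rw [U.map_comp, hk, Category.assoc, ht]
    simp
  · rw [U.map_comp, reassoc_of% ht]
    simp

/-- The forgetful functor from algebras over the monad reflects isomorphisms, so the comparison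
functor inverts the counit. By faithfulness, any preimage of that inverse would invert the counit
itself. -/
theorem comparison_map_not_surjective {A : D} [IsIso (U.map (adj.counit.app A))]
    (hA : ¬ IsIso (adj.counit.app A)) :
    ¬ Function.Surjective fun f : A ⟶ F.obj (U.obj A) => (Monad.comparison adj).map f := by
  intro hs
  have : IsIso ((adj.toMonad.forget).map ((Monad.comparison adj).map (adj.counit.app A))) :=
    inferInstanceAs (IsIso (U.map (adj.counit.app A)))
  have : IsIso ((Monad.comparison adj).map (adj.counit.app A)) :=
    isIso_of_reflects_iso _ adj.toMonad.forget
  obtain ⟨g, hg⟩ := hs (inv ((Monad.comparison adj).map (adj.counit.app A)))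
  refine hA ⟨g, (Monad.comparison adj).map_injective ?_, (Monad.comparison adj).map_injective ?_⟩
  · simp [hg]
  · simp [hg]

/-- A universal arrow out of `U A` whose target `B` maps to `A` by a non-isomorphism that `U`
inverts shows that the counit at `A` is badly behaved. -/
theorem counit_of_universal {A B : D} (f : B ⟶ A) [IsIso (U.map f)] (hiso : ¬ IsIso f)
    (hf : ∀ (Z : D) (g : U.obj A ⟶ U.obj Z), ∃ k : B ⟶ Z, U.map k = U.map f ≫ g) :
    IsIso (U.map (adj.counit.app A)) ∧ ¬ IsIso (adj.counit.app A) ∧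
      ¬ IsRegularEpi (adj.counit.app A) ∧
      ¬ Function.Surjective fun f : A ⟶ F.obj (U.obj A) => (Monad.comparison adj).map f := by
  obtain ⟨φ, hφ⟩ := exists_iso_hom_comp_eq_counit adj f hf
  have h1 : IsIso (U.map (adj.counit.app A)) := by
    rw [← hφ, U.map_comp]
    infer_instance
  have h2 : ¬ IsIso (adj.counit.app A) := fun h => by
    rw [← hφ] at h
    exact hiso (IsIso.of_isIso_comp_left φ.hom f)
  have : Mono (adj.counit.app A) := U.mono_of_mono_map inferInstance
  exact ⟨h1, h2, not_isRegularEpi_of_mono _ h2, comparison_map_not_surjective adj h2⟩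

end Adjunctions

/-! ### Completions -/

namespace OperatorAlgebraSeminorm

variable {𝕜 : Type*} [RCLike 𝕜]

theorem of_one_mul {N : Type*} [Ring N] (a b : N) :
    (Matrix.of fun _ _ => a * b : Matrix (Fin 1) (Fin 1) N) =
      (Matrix.of fun _ _ => a) * (Matrix.of fun _ _ => b) := by
  ext i j
  simp [Matrix.mul_apply]

/-- The Banach algebra obtained by completing the Hausdorff quotient of a seminormed algebra. -/
theorem exists_completion {N : Type u} [Ring N] [Algebra 𝕜 N]
    (p : OperatorAlgebraSeminorm 𝕜 N) :
    ∃ (D : Type u) (_ : NormedRing D) (_ : NormedAlgebra 𝕜 D) (_ : CompleteSpace D)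
      (e : N →ₐ[𝕜] D), DenseRange e ∧ ∀ a, p.seminorm 1 (Matrix.of fun _ _ => a) = ‖e a‖ := by
  let r : RingSeminorm N :=
    { toFun := fun a => p.seminorm 1 (Matrix.of fun _ _ => a)
      map_zero' := map_zero (p.seminorm 1)
      add_le' := fun a b => map_add_le_add (p.seminorm 1) (Matrix.of fun _ _ => a) _
      neg' := fun a => map_neg_eq_map (p.seminorm 1) (Matrix.of fun _ _ => a)
      mul_le' := fun a b => by
        rw [of_one_mul]
        exact p.mul_le _ _ }
  let : SeminormedRing N := r.toSeminormedRing
  let : NormedAlgebra 𝕜 N :=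
    { norm_smul_le := fun c a => (map_smul_eq_mul (p.seminorm 1) c (Matrix.of fun _ _ => a)).le }
  let D := UniformSpace.Completion N
  let : NormedAlgebra 𝕜 D := { norm_smul_le := norm_smul_le }
  refine ⟨D, inferInstance, inferInstance, inferInstance,
    { (UniformSpace.Completion.coeRingHom : N →+* D) with commutes' := fun _ => rfl },
    UniformSpace.Completion.denseRange_coe, fun a => ?_⟩
  exact (UniformSpace.Completion.norm_coe a).symm

end OperatorAlgebraSeminorm

/-! ### Extensions of homomorphisms -/

section Homomorphisms

variable {𝕜 : Type*} [NontriviallyNormedField 𝕜] {N : Type*} [Ring N] [Algebra 𝕜 N]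
  {D : Type*} [NormedRing D] [NormedAlgebra 𝕜 D] {B : Type*} [NormedRing B] [NormedAlgebra 𝕜 B]

theorem exists_algHom_extension [CompleteSpace B] (e : N →ₐ[𝕜] D) (hd : DenseRange e)
    (g : N →ₐ[𝕜] B) (hg : ∀ a, ‖g a‖ ≤ ‖e a‖) :
    ∃ f : D →ₐ[𝕜] B, f.comp e = g ∧ ∀ d, ‖f d‖ ≤ ‖d‖ := by
  have hg' : ∀ a, ‖g.toLinearMap a‖ ≤ 1 * ‖e.toLinearMap a‖ := by simpa using hg
  let f := g.toLinearMap.extendOfNorm e.toLinearMap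
  have hfe : ∀ a, f (e a) = g a := LinearMap.extendOfNorm_eq (e := e.toLinearMap) hd ⟨1, hg'⟩
  refine ⟨AlgHom.ofLinearMap f.toLinearMap ?_ ?_, ?_, fun d => ?_⟩
  · change f 1 = 1
    rw [← map_one e, hfe, map_one]
  · intro x y
    refine hd.induction_on₂ (p := fun x y => f (x * y) = f x * f y)
      (isClosed_eq (by fun_prop) (by fun_prop)) (fun a b => ?_) x y
    rw [← map_mul, hfe, hfe, hfe, map_mul]
  · ext a
    exact hfe a
  · exact (LinearMap.norm_extendOfNorm_apply_le (e := e.toLinearMap) hd 1 hg' d).trans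
      (one_mul _).le

/-- The norm inequality forces `ker e ≤ ker g`, so `g` descends to the image. This replaces
extension to the closure when `B` is incomplete. -/
theorem exists_algHom_range (e : N →ₐ[𝕜] D) (g : N →ₐ[𝕜] B) (hg : ∀ a, ‖g a‖ ≤ ‖e a‖) :
    ∃ f : e.range →ₐ[𝕜] B, (∀ a, f (e.rangeRestrict a) = g a) ∧ ∀ d, ‖f d‖ ≤ ‖d‖ := by
  have hker : ∀ a b, e a = e b → g a = g b := fun a b h => by
    rw [← sub_eq_zero, ← map_sub, ← norm_le_zero_iff]
    exact (hg _).trans (by rw [map_sub, h, sub_self, norm_zero])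
  choose s hs using e.rangeRestrict_surjective
  have hs' : ∀ d, e (s d) = d := fun d => congrArg Subtype.val (hs d)
  refine ⟨AlgHom.ofLinearMap
    { toFun := fun d => g (s d), map_add' := fun x y => ?_, map_smul' := fun c x => ?_ } ?_ ?_,
    fun a => ?_, fun d => ?_⟩
  · rw [← map_add]
    exact hker _ _ (by simp [hs'])
  · rw [RingHom.id_apply, ← map_smul]
    exact hker _ _ (by simp [hs'])
  · exact (hker _ 1 (by simp [hs'])).trans (map_one g)
  · intro x y
    exact (hker _ (s x * s y) (by simp [hs'])).trans (map_mul g _ _)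
  · exact hker _ _ (by simp [hs'])
  · exact (hg _).trans (by rw [hs']; rfl)

end Homomorphisms

/-! ### Free operator algebras -/

noncomputable section FreeOperatorAlgebras

open OperatorAlgebraSeminorm

variable {𝕜 : Type} [RCLike 𝕜]

/-! ### Faithfulness, isomorphisms and maximal structures -/

instance : (OAlg.forget.{u} 𝕜).Faithful where
  map_injective h := OAlg.Hom.ext (congrArg NAlg.Hom.toAlgHom h)

instance : (OAlgHat.forget.{u} 𝕜).Faithful where
  map_injective {A B f g} h := by
    have h1 : (OAlg.forget 𝕜).map f.hom = (OAlg.forget 𝕜).map g.hom :=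
      congrArg (fun k : (OAlgHat.forget 𝕜).obj A ⟶ (OAlgHat.forget 𝕜).obj B => k.hom) h
    exact InducedCategory.hom_ext ((OAlg.forget 𝕜).map_injective h1)

theorem NAlg.bijective_of_isIso {A B : NAlg.{u} 𝕜} (f : A ⟶ B) [IsIso f] :
    Function.Bijective (NAlg.Hom.toAlgHom f) := by
  refine Function.bijective_iff_has_inverse.2 ⟨NAlg.Hom.toAlgHom (inv f), fun a => ?_, fun a => ?_⟩
  · exact DFunLike.congr_fun (congrArg NAlg.Hom.toAlgHom (IsIso.hom_inv_id f)) a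
  · exact DFunLike.congr_fun (congrArg NAlg.Hom.toAlgHom (IsIso.inv_hom_id f)) a

theorem NAlg.isIso_of_bijective {A B : NAlg.{u} 𝕜} (f : A ⟶ B)
    (hf : Function.Bijective (NAlg.Hom.toAlgHom f)) (hn : ∀ a, ‖NAlg.Hom.toAlgHom f a‖ = ‖a‖) :
    IsIso f := by
  let e := AlgEquiv.ofBijective _ hf
  refine ⟨⟨e.symm.toAlgHom, fun b => ?_⟩, NAlg.Hom.ext ?_, NAlg.Hom.ext ?_⟩
  · refine ((hn _).symm.trans (congrArg norm (e.apply_symm_apply b))).le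
  · ext a
    exact e.symm_apply_apply a
  · ext a
    exact e.apply_symm_apply a

theorem OAlg.isIso_iff {A B : OAlg.{u} 𝕜} (f : A ⟶ B) :
    IsIso f ↔ Function.Bijective (OAlg.algHom f) ∧
      IsCompletelyIsometric 𝕜 (OAlg.algHom f).toLinearMap := by
  constructor
  · intro h
    refine ⟨NAlg.bijective_of_isIso ((OAlg.forget 𝕜).map f), fun n x => ?_⟩
    refine le_antisymm (OAlg.Hom.completelyContractive f n x) ?_
    have h1 := OAlg.Hom.completelyContractive (inv f) n (x.map (OAlg.algHom f))
    refine le_of_eq_of_le (congrArg _ ?_) h1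
    ext i j
    exact (DFunLike.congr_fun (congrArg OAlg.Hom.toAlgHom (IsIso.hom_inv_id f)) (x i j)).symm
  · rintro ⟨hf, hn⟩
    let e := AlgEquiv.ofBijective _ hf
    refine ⟨⟨e.symm.toAlgHom, fun n x => ?_⟩, OAlg.Hom.ext ?_, OAlg.Hom.ext ?_⟩
    · refine ((hn n _).symm.trans (congrArg _ ?_)).le
      ext i j
      exact e.apply_symm_apply (x i j)
    · ext a
      exact e.symm_apply_apply a
    · ext a
      exact e.apply_symm_apply a

/-- The existing structure on `A` is one of the competitors and already attains the upper bound
`‖a‖`. -/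
theorem OperatorAlgebraSeminorm.maximal_one_eq_norm {A : Type*} [NormedRing A]
    [NormedAlgebra 𝕜 A] [OperatorAlgebra 𝕜 A] (h1 : ‖(1 : A)‖ ≤ 1) (a : A) :
    (maximal 𝕜 A h1).seminorm 1 (Matrix.of fun _ _ => a) = ‖a‖ := by
  have h : ∀ a : A, (ofOperatorAlgebra 𝕜 A).seminorm 1 (Matrix.of fun _ _ => a) = ‖a‖ := fun a =>
    OperatorSpace.mnorm_one _
  exact le_antisymm (maximal_isContractive h1 a)
    ((h a).symm.le.trans (le_maximal h1 _ (fun a => (h a).le) _))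

theorem OAlg.norm_one_le (A : OAlg.{u} 𝕜) : ‖(1 : A)‖ ≤ 1 :=
  OperatorAlgebra.norm_one_le (𝕜 := 𝕜)

/-- An operator algebra with the largest operator algebra structure for the given norm. -/
def OAlg.max (A : OAlg.{u} 𝕜) : OAlg.{u} 𝕜 :=
  letI := (maximal 𝕜 A A.norm_one_le).toOperatorAlgebra (maximal_one_eq_norm A.norm_one_le)
  ⟨A⟩

theorem OAlg.contractive_comap (A : OAlg.{u} 𝕜) {N : Type*} [NormedRing N] [NormedAlgebra 𝕜 N]
    (g : N →ₐ[𝕜] A) (hg : ∀ a, ‖g a‖ ≤ ‖a‖) : ((ofOperatorAlgebra 𝕜 A).comap g).IsContractive :=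
  fun a => (OperatorSpace.mnorm_one (𝕜 := 𝕜) _).le.trans (hg a)

/-- A contractive homomorphism is completely contractive for the largest structure. -/
def OAlg.maxLift (A B : OAlg.{u} 𝕜) (g : (OAlg.forget 𝕜).obj A ⟶ (OAlg.forget 𝕜).obj B) :
    A.max ⟶ B where
  toAlgHom := NAlg.Hom.toAlgHom g
  completelyContractive _ x := le_maximal A.norm_one_le _
    (B.contractive_comap (NAlg.Hom.toAlgHom g) (NAlg.Hom.contractive g)) x

/-- The identity of an operator algebra as a morphism from its largest structure. -/
def OAlg.fromMax (A : OAlg.{u} 𝕜) : A.max ⟶ A := OAlg.maxLift A A (𝟙 _)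

instance (A : OAlg.{u} 𝕜) : IsIso ((OAlg.forget 𝕜).map A.fromMax) :=
  NAlg.isIso_of_bijective _ Function.bijective_id fun _ => rfl

/-- The norms pulled back from `L(H)` along `ρ` lie below the maximal ones. Were the maximal norms
those of `A`, this would say that `ρ` is completely contractive. -/
theorem OAlg.not_isCompletelyIsometric_fromMax (A : OAlg.{u} 𝕜) {H : Type v}
    [NormedAddCommGroup H] [InnerProductSpace 𝕜 H] (ρ : A →ₐ[𝕜] (H →L[𝕜] H))
    (hρ : ∀ a, ‖ρ a‖ ≤ ‖a‖) (hn : ¬ IsCompletelyContractive 𝕜 ρ.toLinearMap) :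
    ¬ IsCompletelyIsometric 𝕜 (OAlg.algHom A.fromMax).toLinearMap := fun h => hn fun n x => by
  refine (le_maximal A.norm_one_le ((ofBoundedOperators 𝕜 H).comap ρ) (fun a => ?_) x).trans
    (h n x).ge
  exact (OperatorSpace.mnorm_one (𝕜 := 𝕜) (Matrix.of fun _ _ => ρ a)).le.trans (hρ a)

theorem OAlg.not_isIso_fromMax (A : OAlg.{u} 𝕜) {H : Type v}
    [NormedAddCommGroup H] [InnerProductSpace 𝕜 H] (ρ : A →ₐ[𝕜] (H →L[𝕜] H))
    (hρ : ∀ a, ‖ρ a‖ ≤ ‖a‖) (hn : ¬ IsCompletelyContractive 𝕜 ρ.toLinearMap) :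
    ¬ IsIso A.fromMax := fun h =>
  A.not_isCompletelyIsometric_fromMax ρ hρ hn ((OAlg.isIso_iff _).1 h).2

/-- The data of a free operator algebra: a dense homomorphism that is isometric for the largest
operator algebra seminorms. -/
theorem NAlg.exists_completely_contractive_lift (N : NAlg.{u} 𝕜) {D : Type u} [NormedRing D]
    [NormedAlgebra 𝕜 D] (e : N →ₐ[𝕜] D) (hd : DenseRange e)
    (he : ∀ a, (maximal 𝕜 N N.norm_one_le).seminorm 1 (Matrix.of fun _ _ => a) = ‖e a‖) :
    ∃ _ : OperatorAlgebra 𝕜 D, ∀ (B : OAlg.{u} 𝕜) (g : N →ₐ[𝕜] B), (∀ a, ‖g a‖ ≤ ‖a‖) →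
      (∀ a, ‖g a‖ ≤ ‖e a‖) ∧ ∀ f : D →ₐ[𝕜] B, f.comp e = g → Continuous f →
        IsCompletelyContractive 𝕜 f.toLinearMap := by
  obtain ⟨q, hq, hqe⟩ := (maximal 𝕜 N N.norm_one_le).exists_extension e he hd
  have hq1 : ∀ a, q.seminorm 1 (Matrix.of fun _ _ => a) = ‖a‖ := fun a => by
    refine hd.induction_on a (isClosed_eq ((hq 1).comp (by fun_prop)) (by fun_prop)) fun a => ?_
    rw [← he, ← hqe]
    rfl
  refine ⟨q.toOperatorAlgebra hq1, fun B g hg => ?_⟩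
  have hle := fun n x =>
    le_maximal N.norm_one_le _ (B.contractive_comap g hg) (n := n) x
  refine ⟨fun a => ?_, fun f hf hc n x => ?_⟩
  · rw [← he]
    refine le_of_eq_of_le ?_ (hle 1 (Matrix.of fun _ _ => a))
    exact (OperatorSpace.mnorm_one (𝕜 := 𝕜) (Matrix.of fun _ _ => g a)).symm
  -- Extension along the identity of `B` returns the matrix norms of `B`, now with their continuity;
  -- complete contractivity thus becomes a closed condition.
  · have hB : Continuous fun y : Fin n → Fin n → B => 
        OperatorSpace.mnorm (𝕜 := 𝕜) n (Matrix.of y) := by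
      obtain ⟨r, hr, hre⟩ := (ofOperatorAlgebra 𝕜 B).exists_extension (AlgHom.id 𝕜 B)
        (fun a => OperatorSpace.mnorm_one _) Function.surjective_id.denseRange
      refine (hr n).congr fun y => hre n (Matrix.of y)
    refine (denseRange_entries hd n).induction_on
      (p := fun x => OperatorSpace.mnorm (𝕜 := 𝕜) n (Matrix.map x f.toLinearMap) ≤ q.seminorm n x) x
      (isClosed_le (hB.comp ?_) (hq n)) fun x => ?_
    · refine continuous_pi fun i => continuous_pi fun j => ?_
      exact hc.comp ((continuous_apply j).comp (continuous_apply i))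
    · refine (le_of_eq_of_le ?_ (hle n x)).trans (hqe n x).ge
      rw [← hf]
      rfl

theorem algHom_ext_of_denseRange {N D B : Type*} [Ring N] [Algebra 𝕜 N] [NormedRing D]
    [NormedAlgebra 𝕜 D] [NormedRing B] [NormedAlgebra 𝕜 B] {e : N →ₐ[𝕜] D} (hd : DenseRange e)
    {f g : D →ₐ[𝕜] B} (hf : Continuous f) (hg : Continuous g) (h : f.comp e = g.comp e) :
    f = g :=
  DFunLike.coe_injective (hd.equalizer hf hg (funext fun a => DFunLike.congr_fun h a))

theorem OAlg.Hom.continuous {A B : OAlg.{u} 𝕜} (f : A ⟶ B) : Continuous (OAlg.algHom f) :=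
  AddMonoidHomClass.continuous_of_bound (OAlg.algHom f) 1 fun a =>
    (OAlg.Hom.contractive f a).trans (one_mul _).ge

/-- The free object is the image of `N` in its completion for the maximal seminorm, that is, the
Hausdorff quotient; the completion only supplies the normed algebra structure. -/
theorem OAlg.forget_isRightAdjoint : (OAlg.forget.{u} 𝕜).IsRightAdjoint := by
  refine isRightAdjoint_of_universal_arrows fun N => ?_
  obtain ⟨D, _, _, _, e, hd, he⟩ := (maximal 𝕜 N N.norm_one_le).exists_completion
  have hsurj := e.rangeRestrict_surjective
  obtain ⟨_, h⟩ := N.exists_completely_contractive_lift e.rangeRestrict hsurj.denseRange he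
  refine ⟨⟨e.range⟩, ⟨e.rangeRestrict, fun a => ?_⟩, fun Z g => ?_⟩
  · exact (he a).symm.le.trans (maximal_isContractive N.norm_one_le a)
  · obtain ⟨h1, h2⟩ := h Z (NAlg.Hom.toAlgHom g) (NAlg.Hom.contractive g)
    obtain ⟨f, hf, hn⟩ := exists_algHom_range e (NAlg.Hom.toAlgHom g) h1
    have hc : Continuous f :=
      AddMonoidHomClass.continuous_of_bound f 1 fun a => (hn a).trans (one_mul _).ge
    refine ⟨⟨f, h2 f (AlgHom.ext hf) hc⟩, NAlg.Hom.ext (AlgHom.ext hf), fun f' hf' => ?_⟩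
    refine OAlg.Hom.ext (algHom_ext_of_denseRange hsurj.denseRange (OAlg.Hom.continuous f') hc ?_)
    exact (congrArg NAlg.Hom.toAlgHom hf').trans (AlgHom.ext hf).symm

/-- Here the free object is the whole completion, and completeness of the target extends
homomorphisms from the dense image. -/
theorem OAlgHat.forget_isRightAdjoint : (OAlgHat.forget.{u} 𝕜).IsRightAdjoint := by
  refine isRightAdjoint_of_universal_arrows fun N => ?_
  obtain ⟨D, _, _, _, e, hd, he⟩ := (maximal 𝕜 N.obj N.obj.norm_one_le).exists_completion
  obtain ⟨_, h⟩ := N.obj.exists_completely_contractive_lift e hd he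
  refine ⟨⟨⟨D⟩, ‹CompleteSpace D›⟩, ⟨⟨e, fun a => ?_⟩⟩, fun Z g => ?_⟩
  · exact (he a).symm.le.trans (maximal_isContractive N.obj.norm_one_le a)
  · obtain ⟨h1, h2⟩ := h Z.obj (NAlg.Hom.toAlgHom g.hom) (NAlg.Hom.contractive g.hom)
    have : CompleteSpace Z.obj := Z.property
    obtain ⟨f, hf, hn⟩ := exists_algHom_extension e hd (B := Z.obj) (NAlg.Hom.toAlgHom g.hom) h1
    have hc : Continuous f :=
      AddMonoidHomClass.continuous_of_bound f 1 fun a => (hn a).trans (one_mul _).ge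
    refine ⟨⟨⟨f, h2 f hf hc⟩⟩, InducedCategory.hom_ext (NAlg.Hom.ext hf), fun f' hf' => ?_⟩
    refine InducedCategory.hom_ext (OAlg.Hom.ext
      (algHom_ext_of_denseRange hd (OAlg.Hom.continuous f'.hom) hc ?_))
    exact (congrArg (fun k => NAlg.Hom.toAlgHom (InducedCategory.Hom.hom k)) hf').trans hf.symm

/-- The counit of any adjunction at an operator algebra with a contractive representation that is
not completely contractive. -/
theorem OAlg.counit_of_representation (A : OAlg.{u} 𝕜) {H : Type v} [NormedAddCommGroup H]
    [InnerProductSpace 𝕜 H] (ρ : A →ₐ[𝕜] (H →L[𝕜] H)) (hρ : ∀ a, ‖ρ a‖ ≤ ‖a‖)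
    (hn : ¬ IsCompletelyContractive 𝕜 ρ.toLinearMap) (F : NAlg.{u} 𝕜 ⥤ OAlg.{u} 𝕜)
    (adj : F ⊣ OAlg.forget.{u} 𝕜) :
    Function.Bijective (OAlg.algHom (adj.counit.app A)) ∧
      ¬ IsCompletelyIsometric 𝕜 (OAlg.algHom (adj.counit.app A)).toLinearMap ∧
      ¬ IsRegularEpi (adj.counit.app A) ∧
      ∃ B : OAlg.{u} 𝕜, ¬ Function.Surjective
        fun f : A ⟶ B => (Monad.comparison adj).map f := by
  obtain ⟨h1, h2, h3, h4⟩ := counit_of_universal adj A.fromMax (A.not_isIso_fromMax ρ hρ hn)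
    fun Z g => ⟨OAlg.maxLift A Z g, rfl⟩
  have hb : Function.Bijective (OAlg.algHom (adj.counit.app A)) :=
    NAlg.bijective_of_isIso ((OAlg.forget 𝕜).map (adj.counit.app A))
  exact ⟨hb, fun h => h2 ((OAlg.isIso_iff _).2 ⟨hb, h⟩), h3, _, h4⟩

/-- A complete operator algebra with the largest operator algebra structure for the given norm. -/
def OAlgHat.max (A : OAlgHat.{u} 𝕜) : OAlgHat.{u} 𝕜 := ⟨A.obj.max, A.property⟩

/-- The identity of a complete operator algebra as a morphism from its largest structure. -/
def OAlgHat.fromMax (A : OAlgHat.{u} 𝕜) : A.max ⟶ A := ⟨A.obj.fromMax⟩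

instance (A : OAlgHat.{u} 𝕜) : IsIso ((OAlgHat.forget 𝕜).map A.fromMax) :=
  (ObjectProperty.isIso_hom_iff _).1 (inferInstanceAs (IsIso ((OAlg.forget 𝕜).map A.obj.fromMax)))

theorem OAlgHat.not_isIso_fromMax (A : OAlgHat.{u} 𝕜) {H : Type v}
    [NormedAddCommGroup H] [InnerProductSpace 𝕜 H] (ρ : A.obj →ₐ[𝕜] (H →L[𝕜] H))
    (hρ : ∀ a, ‖ρ a‖ ≤ ‖a‖) (hn : ¬ IsCompletelyContractive 𝕜 ρ.toLinearMap) :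
    ¬ IsIso A.fromMax := fun h =>
  A.obj.not_isIso_fromMax ρ hρ hn ((ObjectProperty.isIso_hom_iff _).2 h)

/-- The counit of any adjunction at a complete operator algebra with a contractive representation
that is not completely contractive. -/
theorem OAlgHat.counit_of_representation (A : OAlgHat.{u} 𝕜) {H : Type v} [NormedAddCommGroup H]
    [InnerProductSpace 𝕜 H] (ρ : A.obj →ₐ[𝕜] (H →L[𝕜] H)) (hρ : ∀ a, ‖ρ a‖ ≤ ‖a‖)
    (hn : ¬ IsCompletelyContractive 𝕜 ρ.toLinearMap) (F : NAlgHat.{u} 𝕜 ⥤ OAlgHat.{u} 𝕜)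
    (adj : F ⊣ OAlgHat.forget.{u} 𝕜) :
    Function.Bijective (OAlg.algHom (adj.counit.app A).hom) ∧
      ¬ IsCompletelyIsometric 𝕜 (OAlg.algHom (adj.counit.app A).hom).toLinearMap ∧
      ¬ IsRegularEpi (adj.counit.app A) ∧
      ∃ B : OAlgHat.{u} 𝕜, ¬ Function.Surjective
        fun f : A ⟶ B => (Monad.comparison adj).map f := by
  obtain ⟨h1, h2, h3, h4⟩ := counit_of_universal adj A.fromMax (A.not_isIso_fromMax ρ hρ hn)
    fun Z g => ⟨⟨OAlg.maxLift A.obj Z.obj g.hom⟩, rfl⟩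
  have hb : Function.Bijective (OAlg.algHom (adj.counit.app A).hom) :=
    NAlg.bijective_of_isIso ((OAlgHat.forget 𝕜).map (adj.counit.app A)).hom
  exact ⟨hb, fun h => h2 ((ObjectProperty.isIso_hom_iff _).1 ((OAlg.isIso_iff _).2 ⟨hb, h⟩)),
    h3, _, h4⟩

theorem OAlg.not_isPreMonadic_of_representation (A : OAlg.{u} 𝕜) {H : Type v}
    [NormedAddCommGroup H] [InnerProductSpace 𝕜 H] (ρ : A →ₐ[𝕜] (H →L[𝕜] H))
    (hρ : ∀ a, ‖ρ a‖ ≤ ‖a‖) (hn : ¬ IsCompletelyContractive 𝕜 ρ.toLinearMap) :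
    ¬ IsPreMonadic (OAlg.forget.{u} 𝕜) :=
  not_isPreMonadic_of_comparison fun F adj =>
    (A.counit_of_representation ρ hρ hn F adj).2.2.2

theorem OAlgHat.not_isPreMonadic_of_representation (A : OAlgHat.{u} 𝕜) {H : Type v}
    [NormedAddCommGroup H] [InnerProductSpace 𝕜 H] (ρ : A.obj →ₐ[𝕜] (H →L[𝕜] H))
    (hρ : ∀ a, ‖ρ a‖ ≤ ‖a‖) (hn : ¬ IsCompletelyContractive 𝕜 ρ.toLinearMap) :
    ¬ IsPreMonadic (OAlgHat.forget.{u} 𝕜) :=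
  not_isPreMonadic_of_comparison fun F adj =>
    (A.counit_of_representation ρ hρ hn F adj).2.2.2

end FreeOperatorAlgebras

/-! ### Contractive representations of the polydisc algebra -/

noncomputable section PolydiscAlgebra

open scoped Matrix.Norms.L2Operator

theorem exists_norm_eq_one_mul_eq_norm (z : ℂ) : ∃ w : Circle, (w : ℂ) * z = ‖z‖ := by
  by_cases hz : z = 0
  · exact ⟨1, by simp [hz]⟩
  · refine ⟨⟨‖z‖ / z, by simp [Submonoid.unitSphere, hz]⟩, ?_⟩
    simp [hz]

/-! ### A Schwarz-type coefficient estimate on the disc -/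

namespace Polynomial

/-- If `f` is bounded by `M` on the unit circle, then `M` bounds the compression of the
multiplication by `f` to the polynomials of degree at most one. -/
theorem norm_sq_coeff_le (f : Polynomial ℂ) (M : ℝ) (hf : ∀ z : Circle, ‖f.eval (z : ℂ)‖ ≤ M)
    (c₀ c₁ : ℂ) : ‖f.coeff 0 * c₀‖ ^ 2 + ‖f.coeff 0 * c₁ + f.coeff 1 * c₀‖ ^ 2 ≤
      M ^ 2 * (‖c₀‖ ^ 2 + ‖c₁‖ ^ 2) := by
  -- Parseval's identity with all but two coefficients dropped. It is applied to `f * g` with `g =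
  -- c₀ + c₁ X`, whose mean square is at most `M ^ 2` times that of `g`.
  have hsum : ∀ g : Polynomial ℂ, ‖g.coeff 0‖ ^ 2 + ‖g.coeff 1‖ ^ 2 ≤
      Real.circleAverage (fun θ ↦ ‖g.eval θ‖ ^ 2) 0 1 := fun g => by
    rw [← g.sum_sq_norm_coeff_eq_circleAverage]
    have h1 : ∑ i ∈ g.support, ‖g.coeff i‖ ^ 2 = ∑ i ∈ g.support ∪ {0, 1}, ‖g.coeff i‖ ^ 2 :=
      Finset.sum_subset Finset.subset_union_left fun i _ hi => by
        simp [Polynomial.notMem_support_iff.1 hi]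
    rw [h1, ← Finset.sum_pair (f := fun i => ‖g.coeff i‖ ^ 2) zero_ne_one]
    exact Finset.sum_le_sum_of_subset_of_nonneg Finset.subset_union_right fun _ _ _ => by positivity
  let g : Polynomial ℂ := C c₀ + C c₁ * X
  have hg : Real.circleAverage (fun θ ↦ ‖g.eval θ‖ ^ 2) 0 1 = ‖c₀‖ ^ 2 + ‖c₁‖ ^ 2 := by
    rw [← g.sum_sq_norm_coeff_eq_circleAverage]
    have h1 : ∑ i ∈ g.support, ‖g.coeff i‖ ^ 2 = ∑ i ∈ {0, 1}, ‖g.coeff i‖ ^ 2 :=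
      Finset.sum_subset (fun i hi => by
        by_contra h
        simp only [Finset.mem_insert, Finset.mem_singleton, not_or] at h
        refine (Polynomial.mem_support_iff.1 hi) ?_
        simp [g, Polynomial.coeff_C, Polynomial.coeff_X, h.1, Ne.symm h.2]) fun i _ hi => by
        simp [Polynomial.notMem_support_iff.1 hi]
    rw [h1, Finset.sum_pair zero_ne_one]
    simp [g, Polynomial.coeff_C]
  have hM : 0 ≤ M := (norm_nonneg _).trans (hf 1)
  have h := hsum (f * g)
  have h0 : (f * g).coeff 0 = f.coeff 0 * c₀ := by simp [g, Polynomial.mul_coeff_zero]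
  have h1 : (f * g).coeff 1 = f.coeff 0 * c₁ + f.coeff 1 * c₀ := by
    simp [g, Polynomial.mul_coeff_one, Polynomial.coeff_C]
  rw [h0, h1] at h
  refine h.trans ?_
  have e : M ^ 2 * Real.circleAverage (fun θ ↦ ‖g.eval θ‖ ^ 2) 0 1 =
      Real.circleAverage (fun θ ↦ M ^ 2 • ‖g.eval θ‖ ^ 2) 0 1 :=
    (Real.circleAverage_fun_smul (a := M ^ 2) (f := fun θ : ℂ ↦ ‖g.eval θ‖ ^ 2)).symm
  rw [← hg, e]
  refine Real.circleAverage_mono ?_ ?_ fun z hz => ?_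
  · exact ContinuousOn.circleIntegrable zero_le_one (by fun_prop)
  · exact ContinuousOn.circleIntegrable zero_le_one (by fun_prop)
  · rw [Polynomial.eval_mul, norm_mul, mul_pow, smul_eq_mul]
    have := hf ⟨z, by simpa [Submonoid.unitSphere] using hz⟩
    gcongr

/-- Giving `c₀` the phase that makes `f.coeff 1` positive, and `c₁` the one for `f.coeff 0`, aligns
the two summands, so the coefficients may be replaced by their moduli. -/
theorem norm_coeff_le (f : Polynomial ℂ) (M : ℝ) (hf : ∀ z : Circle, ‖f.eval (z : ℂ)‖ ≤ M)
    (x y : ℝ) (hx : 0 ≤ x) (hy : 0 ≤ y) :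
    (‖f.coeff 0‖ * x) ^ 2 + (‖f.coeff 0‖ * y + ‖f.coeff 1‖ * x) ^ 2 ≤ M ^ 2 * (x ^ 2 + y ^ 2) := by
  obtain ⟨w₀, h₀⟩ := exists_norm_eq_one_mul_eq_norm (f.coeff 0)
  obtain ⟨w₁, h₁⟩ := exists_norm_eq_one_mul_eq_norm (f.coeff 1)
  have h := f.norm_sq_coeff_le M hf (w₁ * x) (w₀ * y)
  have e : f.coeff 0 * (w₀ * y) + f.coeff 1 * (w₁ * x) =
      ((‖f.coeff 0‖ * y + ‖f.coeff 1‖ * x : ℝ) : ℂ) := by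
    push_cast
    rw [← h₀, ← h₁]
    ring
  rw [e, Complex.norm_of_nonneg (by positivity)] at h
  simpa [abs_of_nonneg hx, abs_of_nonneg hy, Circle.norm_coe] using h

end Polynomial

/-! ### Nilpotent corners and square zero extensions -/

section Corner

variable {𝕜 : Type*} [RCLike 𝕜] {K : Type*} [NormedAddCommGroup K] [InnerProductSpace 𝕜 K]

/-- The operator `[[0, 0], [B, 0]]` on `K ⊕ K`. -/
def corner : (K →L[𝕜] K) →ₗ[𝕜] (WithLp 2 (K × K) →L[𝕜] WithLp 2 (K × K)) where
  toFun B := ((WithLp.prodContinuousLinearEquiv 2 𝕜 K K).symm : K × K →L[𝕜] WithLp 2 (K × K)) ∘L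
    ContinuousLinearMap.inr 𝕜 K K ∘L B ∘L ContinuousLinearMap.fst 𝕜 K K ∘L
    ((WithLp.prodContinuousLinearEquiv 2 𝕜 K K) : WithLp 2 (K × K) →L[𝕜] K × K)
  map_add' x y := by ext v; simp
  map_smul' c x := by ext v; simp

theorem corner_apply (B : K →L[𝕜] K) (v : WithLp 2 (K × K)) :
    corner B v = WithLp.toLp 2 (0, B v.fst) := rfl

theorem corner_mul_corner (B B' : K →L[𝕜] K) : corner B * corner B' = 0 := by
  ext v; simp [corner_apply]

/-- The operator sends `(v, w)` to `(a v, a w + B v)`, so its norm is controlled by the scalar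
matrix `[[|a|, 0], [s, |a|]]` acting on `(‖v‖, ‖w‖)`. -/
theorem norm_algebraMap_add_corner_le (a : 𝕜) (B : K →L[𝕜] K) (s M : ℝ) (hs : ‖B‖ ≤ s)
    (hM : 0 ≤ M) (h : ∀ x y : ℝ, 0 ≤ x → 0 ≤ y →
      (‖a‖ * x) ^ 2 + (‖a‖ * y + s * x) ^ 2 ≤ M ^ 2 * (x ^ 2 + y ^ 2)) :
    ‖algebraMap 𝕜 _ a + corner B‖ ≤ M := by
  refine ContinuousLinearMap.opNorm_le_bound _ hM fun v => ?_
  refine le_of_sq_le_sq ?_ (by positivity)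
  rw [mul_pow, WithLp.prod_norm_sq_eq_of_L2, WithLp.prod_norm_sq_eq_of_L2]
  refine le_trans ?_ (h ‖v.fst‖ ‖v.snd‖ (norm_nonneg _) (norm_nonneg _))
  have h1 : ((algebraMap 𝕜 (WithLp 2 (K × K) →L[𝕜] WithLp 2 (K × K)) a + corner B) v).fst =
      a • v.fst := by simp [corner_apply, Algebra.algebraMap_eq_smul_one]
  have h2 : ((algebraMap 𝕜 (WithLp 2 (K × K) →L[𝕜] WithLp 2 (K × K)) a + corner B) v).snd =
      a • v.snd + B v.fst := by simp [corner_apply, Algebra.algebraMap_eq_smul_one]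
  rw [h1, h2, norm_smul]
  gcongr
  refine (norm_add_le _ _).trans ?_
  rw [norm_smul]
  gcongr
  exact B.le_of_opNorm_le hs _

/-- The representation of a square zero extension by operators `[[a, 0], [∑ i, b i • U i, a]]`. -/
def cornerRep {n : ℕ} (U : Fin n → (K →L[𝕜] K)) :
    TrivSqZeroExt 𝕜 (Fin n → 𝕜) →ₐ[𝕜] (WithLp 2 (K × K) →L[𝕜] WithLp 2 (K × K)) :=
  TrivSqZeroExt.lift (Algebra.ofId 𝕜 _) (corner ∘ₗ Fintype.linearCombination 𝕜 U)
    (fun _ _ => corner_mul_corner _ _)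
    (fun r x => by
      rw [map_smul, Algebra.ofId_apply, Algebra.algebraMap_eq_smul_one, smul_mul_assoc, one_mul])
    (fun r x => by
      rw [op_smul_eq_smul, map_smul, Algebra.ofId_apply, Algebra.algebraMap_eq_smul_one,
        mul_smul_comm, mul_one])

theorem cornerRep_apply {n : ℕ} (U : Fin n → (K →L[𝕜] K)) (t : TrivSqZeroExt 𝕜 (Fin n → 𝕜)) :
    cornerRep U t = algebraMap 𝕜 _ t.fst + corner (∑ i, t.snd i • U i) := rfl

end Corner

/-- The value and the gradient of a polynomial at the origin. -/
def oneJet (n : ℕ) : MvPolynomial (Fin n) ℂ →ₐ[ℂ] TrivSqZeroExt ℂ (Fin n → ℂ) :=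
  MvPolynomial.aeval fun i => TrivSqZeroExt.inr (Pi.single i 1)

/-- The chain rule for the restriction of `P` to the complex line through the origin in direction
`w`. -/
theorem coeff_aeval_eq_oneJet {n : ℕ} (w : Fin n → ℂ) (P : MvPolynomial (Fin n) ℂ) :
    (MvPolynomial.aeval (fun i => Polynomial.C (w i) * Polynomial.X) P).coeff 0 =
        (oneJet n P).fst ∧
      (MvPolynomial.aeval (fun i => Polynomial.C (w i) * Polynomial.X) P).coeff 1 =
        ∑ i, w i * (oneJet n P).snd i := by
  induction P using MvPolynomial.induction_on with
  | C a => simp [oneJet, MvPolynomial.algHom_C, Polynomial.coeff_C,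
      TrivSqZeroExt.algebraMap_eq_inl]
  | add p q hp hq =>
    simp only [map_add, Polynomial.coeff_add, TrivSqZeroExt.fst_add, TrivSqZeroExt.snd_add,
      Pi.add_apply, mul_add, Finset.sum_add_distrib, hp, hq, and_self]
  | mul_X p i hp =>
    have h1 : oneJet n (p * MvPolynomial.X i) = oneJet n p * TrivSqZeroExt.inr (Pi.single i 1) := by
      simp [oneJet]
    rw [h1, map_mul, MvPolynomial.aeval_X]
    constructor
    · simp [Polynomial.mul_coeff_zero]
    · rw [← mul_assoc, Polynomial.coeff_mul_X, Polynomial.coeff_mul_C, hp.1]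
      simp [Pi.single_apply, mul_comm]

/-- The coordinate functions on the torus. -/
def torusCoord {n : ℕ} (i : Fin n) : C(Fin n → Circle, ℂ) := ⟨fun z => (z i : ℂ), by fun_prop⟩

/-- The corner `∑ bᵢ Uᵢ` has norm at most `∑ |bᵢ|`. With phases `wᵢ` making every `wᵢ bᵢ`
nonnegative, this sum is the linear coefficient of the restriction of `P` to the line `z ↦ (wᵢ z)`,
which maps the circle into the torus. The one-variable estimate then applies. -/
theorem norm_cornerRep_oneJet_le {K : Type*} [NormedAddCommGroup K] [InnerProductSpace ℂ K] {n : ℕ}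
    (U : Fin n → (K →L[ℂ] K)) (hU : ∀ i, ‖U i‖ ≤ 1) (P : MvPolynomial (Fin n) ℂ) :
    ‖cornerRep U (oneJet n P)‖ ≤ ‖MvPolynomial.aeval (R := ℂ) torusCoord P‖ := by
  choose w hw using fun i => exists_norm_eq_one_mul_eq_norm ((oneJet n P).snd i)
  let f : Polynomial ℂ := MvPolynomial.aeval (fun i => Polynomial.C (w i : ℂ) * Polynomial.X) P
  obtain ⟨h0, h1⟩ := coeff_aeval_eq_oneJet (fun i => (w i : ℂ)) P
  have hf : ∀ z : Circle, ‖f.eval (z : ℂ)‖ ≤ ‖MvPolynomial.aeval (R := ℂ) torusCoord P‖ :=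
    fun z => by
    have e : ((Polynomial.aeval (z : ℂ)).comp
        (MvPolynomial.aeval fun i => Polynomial.C (w i : ℂ) * Polynomial.X)) =
        (ContinuousMap.evalAlgHom ℂ ℂ (fun i => w i * z)).comp
          (MvPolynomial.aeval (R := ℂ) torusCoord) := by
      ext i
      simp [torusCoord]
    have e1 := DFunLike.congr_fun e P
    refine le_of_eq_of_le (congrArg norm ?_) (ContinuousMap.norm_coe_le_norm _ fun i => w i * z)
    exact e1
  have hs : f.coeff 1 = ((∑ i, ‖(oneJet n P).snd i‖ : ℝ) : ℂ) := by
    rw [h1]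
    push_cast
    exact Finset.sum_congr rfl fun i _ => hw i
  rw [cornerRep_apply]
  refine norm_algebraMap_add_corner_le _ _ (∑ i, ‖(oneJet n P).snd i‖) _ ?_ (norm_nonneg _)
    fun x y hx hy => ?_
  · refine (norm_sum_le _ _).trans (Finset.sum_le_sum fun i _ => ?_)
    rw [norm_smul]
    exact mul_le_of_le_one_right (norm_nonneg _) (hU i)
  · have h := f.norm_coeff_le _ hf x y hx hy
    rw [hs, Complex.norm_of_nonneg (by positivity)] at h
    rwa [← h0]

/-! ### Parrott's example -/

theorem l2_opNorm_le_sqrt_sum_sq {𝕜 : Type*} [RCLike 𝕜] {m n : ℕ}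
    (A : Matrix (Fin m) (Fin n) 𝕜) : ‖A‖ ≤ √(∑ i, ∑ j, ‖A i j‖ ^ 2) := by
  rw [Matrix.l2_opNorm_def]
  refine ContinuousLinearMap.opNorm_le_bound _ (by positivity) fun v => ?_
  refine le_of_sq_le_sq ?_ (by positivity)
  rw [mul_pow, Real.sq_sqrt (by positivity), EuclideanSpace.norm_sq_eq, EuclideanSpace.norm_sq_eq,
    Finset.sum_mul]
  refine Finset.sum_le_sum fun i _ => ?_
  refine le_trans ?_ (Finset.sum_mul_sq_le_sq_mul_sq Finset.univ (fun j => ‖A i j‖) fun j => ‖v j‖)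
  refine pow_le_pow_left₀ (norm_nonneg _) ?_ 2
  simp_rw [← norm_mul]
  exact norm_sum_le Finset.univ fun j => A i j * v j

/-- Three noncommuting unitary matrices, extended by zero. -/
def parrottMatrix (k : ℕ) : Matrix (Fin 2) (Fin 2) ℂ :=
  match k with
  | 0 => !![1, 0; 0, 1]
  | 1 => !![1, 0; 0, -1]
  | 2 => !![0, 1; 1, 0]
  | _ => 0

theorem norm_parrottMatrix_le (k : ℕ) : ‖parrottMatrix k‖ ≤ 1 := by
  have h : ∀ M : Matrix (Fin 2) (Fin 2) ℂ, M.conjTranspose * M = 1 → ‖M‖ ≤ 1 := fun M hM => by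
    have h1 := Matrix.l2_opNorm_conjTranspose_mul_self M
    rw [hM, norm_one] at h1
    nlinarith [norm_nonneg M]
  match k with
  | 0 | 1 | 2 =>
    refine h _ ?_
    ext i j
    fin_cases i <;> fin_cases j <;> simp [parrottMatrix, Matrix.mul_apply]
  | k + 3 => simp [parrottMatrix]

/-- The contractions on `ℂ²` given by the matrices `parrottMatrix`. -/
def parrottOp (k : ℕ) : EuclideanSpace ℂ (Fin 2) →L[ℂ] EuclideanSpace ℂ (Fin 2) :=
  Matrix.toEuclideanCLM (𝕜 := ℂ) (parrottMatrix k)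

/-- Contractions `U i` on `K` give a contractive representation of the polydisc algebra that maps
the coordinates to the operators `[[0, 0], [U i, 0]]`. -/
theorem exists_corner_representation {K : Type*} [NormedAddCommGroup K] [InnerProductSpace ℂ K]
    {n : ℕ} (U : Fin n → (K →L[ℂ] K)) (hU : ∀ i, ‖U i‖ ≤ 1) :
    ∃ ρ : polydiscAlgebra n →ₐ[ℂ] (WithLp 2 (K × K) →L[ℂ] WithLp 2 (K × K)),
      (∀ p, ‖ρ p‖ ≤ ‖p‖) ∧ ∀ i, ∃ z : polydiscAlgebra n,
        (∀ t : Fin n → Circle, ‖(z : C(Fin n → Circle, ℂ)) t‖ = 1) ∧ ρ z = corner (U i) := by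
  obtain ⟨ρ, hρe, hρ⟩ := exists_algHom_range (B := WithLp 2 (K × K) →L[ℂ] WithLp 2 (K × K))
    (MvPolynomial.aeval (R := ℂ) (torusCoord (n := n)))
    ((cornerRep U).comp (oneJet n)) (norm_cornerRep_oneJet_le U hU)
  refine ⟨ρ, hρ, fun i => ⟨(MvPolynomial.aeval (R := ℂ) torusCoord).rangeRestrict
      (MvPolynomial.X i), fun t => ?_, (hρe _).trans ?_⟩⟩
  · simpa [torusCoord] using Circle.norm_coe _
  · simp [oneJet, cornerRep_apply, Pi.single_apply]

theorem exists_contractive_representation_polydiscAlgebra (n : ℕ) (hn : 3 ≤ n) :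
    ∃ (H : Type) (_ : NormedAddCommGroup H) (_ : InnerProductSpace ℂ H)
      (_ : CompleteSpace H) (ρ : polydiscAlgebra n →ₐ[ℂ] (H →L[ℂ] H)),
      (∀ p, ‖ρ p‖ ≤ ‖p‖) ∧ ¬ IsCompletelyContractive ℂ ρ.toLinearMap := by
  obtain ⟨ρ, hρ, hz⟩ := exists_corner_representation (fun i : Fin n => parrottOp i)
    fun i => norm_parrottMatrix_le i
  refine ⟨_, _, _, inferInstance, ρ, hρ, fun hcc => ?_⟩
  obtain ⟨z₀, hz₀, hρ₀⟩ := hz ⟨0, by omega⟩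
  obtain ⟨z₁, hz₁, hρ₁⟩ := hz ⟨1, by omega⟩
  obtain ⟨z₂, hz₂, hρ₂⟩ := hz ⟨2, by omega⟩
  -- This is `∑ zₖ Uₖ` with the three unitaries as scalar coefficients. On the torus its squared
  -- Frobenius norm is `2 (1 + 1) + 2 = 6`, by the parallelogram law.
  let x : Matrix (Fin 2) (Fin 2) (polydiscAlgebra n) := !![z₀ + z₁, z₂; z₂, z₀ - z₁]
  have hx : OperatorSpace.mnorm (𝕜 := ℂ) 2 x ≤ √6 := by
    refine (ContinuousMap.norm_le _ (by positivity)).2 fun t => ?_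
    refine (l2_opNorm_le_sqrt_sum_sq _).trans (Real.sqrt_le_sqrt ?_)
    have h := parallelogram_law_with_norm ℂ ((z₀ : C(Fin n → Circle, ℂ)) t)
      ((z₁ : C(Fin n → Circle, ℂ)) t)
    rw [hz₀, hz₁] at h
    simp only [Fin.sum_univ_two, funMatrix, x]
    simp [hz₂]
    nlinarith
  let b : Fin 2 → WithLp 2 (EuclideanSpace ℂ (Fin 2) × EuclideanSpace ℂ (Fin 2)) := fun i =>
    WithLp.toLp 2 (EuclideanSpace.single i 1, 0)
  have hb : ∀ i, ‖b i‖ = 1 := fun i => by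
    simp [b]
  -- The vector `∑ eᵢ ⊗ eᵢ`, placed in the first summand. Each `Uₖ` is a real symmetric unitary, so
  -- `Uₖ ⊗ Uₖ` fixes `∑ eᵢ ⊗ eᵢ`, and the three terms add up to the factor `3`; but `3 > √6`.
  let v : PiLp 2 fun _ : Fin 2 =>
    WithLp 2 (EuclideanSpace ℂ (Fin 2) × EuclideanSpace ℂ (Fin 2)) := WithLp.toLp 2 b
  have hv : ‖v‖ ^ 2 = 2 := by
    rw [PiLp.norm_sq_eq_of_L2, Fin.sum_univ_two]
    change ‖b 0‖ ^ 2 + ‖b 1‖ ^ 2 = 2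
    rw [hb, hb]
    norm_num
  have hcorner : ∀ i k, corner (parrottOp k) (b i) =
      WithLp.toLp 2 (0, WithLp.toLp 2 fun j => parrottMatrix k j i) := fun i k => by
    refine congrArg (fun w => WithLp.toLp 2 (0, w)) ?_
    ext j
    simp [b, parrottOp, Matrix.mulVec_single]
  have h1 : ∀ i, opMatrix 2 (x.map ρ) v i =
      (3 : ℂ) •
        WithLp.toLp 2 ((0 : EuclideanSpace ℂ (Fin 2)), EuclideanSpace.single i (1 : ℂ)) := by
    intro i
    rw [opMatrix_apply, Fin.sum_univ_two]
    fin_cases i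
    · change ρ (z₀ + z₁) (b 0) + ρ z₂ (b 1) = _
      rw [map_add, hρ₀, hρ₁, hρ₂, add_apply, hcorner, hcorner, hcorner]
      refine WithLp.ofLp_injective 2 ?_
      ext j
      · simp
      · fin_cases j <;> simp [parrottMatrix]
        norm_num
    · change ρ z₂ (b 0) + ρ (z₀ - z₁) (b 1) = _
      rw [map_sub, hρ₀, hρ₁, hρ₂, sub_apply, hcorner, hcorner, hcorner]
      refine WithLp.ofLp_injective 2 ?_
      ext j
      · simp
      · fin_cases j <;> simp [parrottMatrix]
        norm_num
  have h2 : ‖opMatrix 2 (x.map ρ) v‖ ^ 2 = 18 := by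
    rw [PiLp.norm_sq_eq_of_L2]
    simp [h1, norm_smul]
    norm_num
  have h3 : ‖opMatrix 2 (x.map ρ)‖ ≤ √6 := (hcc 2 x).trans hx
  have h4 := (opMatrix 2 (x.map ρ)).le_of_opNorm_le h3 v
  have h5 := pow_le_pow_left₀ (norm_nonneg _) h4 2
  rw [h2, mul_pow, hv, Real.sq_sqrt (by norm_num)] at h5
  norm_num at h5

end PolydiscAlgebra

/-! ### An algebra with a contractive representation that is not completely contractive -/

noncomputable section ColumnAlgebra

open scoped Matrix.Norms.L2Operator

variable {𝕜 : Type*} [RCLike 𝕜]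

/-- The transpose is the entrywise conjugate of the adjoint, and conjugating the entries of a matrix
amounts to conjugating input and output vectors, which preserves norms. -/
theorem l2_opNorm_transpose_le {m n : ℕ} (A : Matrix (Fin m) (Fin n) 𝕜) :
    ‖A.transpose‖ ≤ ‖A‖ := by
  rw [← Matrix.l2_opNorm_conjTranspose A.transpose, Matrix.l2_opNorm_def]
  refine ContinuousLinearMap.opNorm_le_bound _ (norm_nonneg _) fun v => ?_
  have h := A.l2_opNorm_mulVec (WithLp.toLp 2 fun j => star (v j))
  have h1 : ‖(WithLp.toLp 2 fun j => star (v j) : EuclideanSpace 𝕜 (Fin n))‖ = ‖v‖ := by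
    simp [EuclideanSpace.norm_eq]
  rw [h1] at h
  refine le_of_eq_of_le ?_ h
  rw [EuclideanSpace.norm_eq, EuclideanSpace.norm_eq]
  congr 1
  refine Finset.sum_congr rfl fun i _ => ?_
  congr 1
  rw [← norm_star]
  simp [Matrix.mulVec, dotProduct]

theorem completeSpace_subalgebra (𝕜 : Type*) [RCLike 𝕜] {E : Type*} [NormedRing E]
    [NormedAlgebra 𝕜 E] [FiniteDimensional 𝕜 E] (S : Subalgebra 𝕜 E) : CompleteSpace S :=
  FiniteDimensional.complete 𝕜 (Subalgebra.toSubmodule S)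

/-- The matrices whose only nonzero entries are in the first column below the diagonal. -/
def columnMatrix : (Fin 2 → 𝕜) →ₗ[𝕜] Matrix (Fin 3) (Fin 3) 𝕜 where
  toFun b := !![0, 0, 0; b 0, 0, 0; b 1, 0, 0]
  map_add' a b := by ext i j; fin_cases i <;> fin_cases j <;> simp
  map_smul' c b := by ext i j; fin_cases i <;> fin_cases j <;> simp

theorem columnMatrix_mul (a b : Fin 2 → 𝕜) : columnMatrix a * columnMatrix b = 0 := by
  ext i j
  fin_cases i <;> fin_cases j <;> simp [columnMatrix, Matrix.mul_apply, Fin.sum_univ_three]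

/-- The square zero extension of `𝕜` by the column space, as an algebra of matrices. -/
def columnRep : TrivSqZeroExt 𝕜 (Fin 2 → 𝕜) →ₐ[𝕜] Matrix (Fin 3) (Fin 3) 𝕜 :=
  TrivSqZeroExt.lift (Algebra.ofId 𝕜 _) columnMatrix columnMatrix_mul
    (fun r x => by
      rw [map_smul, Algebra.ofId_apply, Algebra.algebraMap_eq_smul_one, smul_mul_assoc, one_mul])
    (fun r x => by
      rw [op_smul_eq_smul, map_smul, Algebra.ofId_apply, Algebra.algebraMap_eq_smul_one,
        mul_smul_comm, mul_one])

/-- The transposed representation of the column algebra. -/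
def rowRep : TrivSqZeroExt 𝕜 (Fin 2 → 𝕜) →ₐ[𝕜] Matrix (Fin 3) (Fin 3) 𝕜 :=
  AlgHom.ofLinearMap ((Matrix.transposeLinearEquiv (Fin 3) (Fin 3) 𝕜 𝕜).toLinearMap ∘ₗ
      columnRep.toLinearMap)
    (by simp)
    (fun x y => by
      change (columnRep (x * y)).transpose = (columnRep x).transpose * (columnRep y).transpose
      -- Transposition reverses products; commutativity of the square zero extension repairs this.
      rw [← Matrix.transpose_mul, ← map_mul, mul_comm])

theorem rowRep_apply (t : TrivSqZeroExt 𝕜 (Fin 2 → 𝕜)) : rowRep t = (columnRep t).transpose := rfl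

theorem columnRep_inr (b : Fin 2 → 𝕜) : columnRep (TrivSqZeroExt.inr b) = columnMatrix b :=
  TrivSqZeroExt.lift_apply_inr ..

variable (𝕜) in
/-- The identification of matrices with operators on the Euclidean space. -/
def matrixToOperator (n : ℕ) : Matrix (Fin n) (Fin n) 𝕜 →ₐ[𝕜]
    (EuclideanSpace 𝕜 (Fin n) →L[𝕜] EuclideanSpace 𝕜 (Fin n)) :=
  AlgHomClass.toAlgHom (Matrix.toEuclideanCLM (𝕜 := 𝕜) (n := Fin n))

theorem matrixToOperator_apply {n : ℕ} (A : Matrix (Fin n) (Fin n) 𝕜)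
    (v : EuclideanSpace 𝕜 (Fin n)) (i : Fin n) :
    matrixToOperator 𝕜 n A v i = ∑ j, A i j * v j := rfl

/-- The operator algebra structure given by an isometric representation. -/
def OAlg.ofRepresentation {𝕜 : Type} [RCLike 𝕜] {S : Type u} [NormedRing S] [NormedAlgebra 𝕜 S]
    {H : Type v} [NormedAddCommGroup H] [InnerProductSpace 𝕜 H] (π : S →ₐ[𝕜] (H →L[𝕜] H))
    (hπ : ∀ a, ‖π a‖ = ‖a‖) : OAlg.{u} 𝕜 :=
  letI := ((OperatorAlgebraSeminorm.ofBoundedOperators 𝕜 H).comap π).toOperatorAlgebra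
    fun a => (OperatorSpace.mnorm_one (𝕜 := 𝕜) (Matrix.of fun _ _ => π a)).trans (hπ a)
  ⟨S⟩

/-- Two representations with comparable norms, but not on matrices, give an operator algebra, in
any universe, with a contractive representation that is not completely contractive. -/
theorem OAlgHat.exists_of_representations {𝕜 : Type} [RCLike 𝕜] {R : Type*} [Ring R]
    [Algebra 𝕜 R] {H : Type} [NormedAddCommGroup H] [InnerProductSpace 𝕜 H]
    [FiniteDimensional 𝕜 (H →L[𝕜] H)] (φ ψ : R →ₐ[𝕜] (H →L[𝕜] H))
    (h : ∀ a, ‖ψ a‖ ≤ ‖φ a‖) (n : ℕ) (x : Matrix (Fin n) (Fin n) R)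
    (hx : ‖opMatrix n (x.map φ)‖ < ‖opMatrix n (x.map ψ)‖) :
    ∃ (A : OAlgHat.{u} 𝕜) (ρ : A.obj →ₐ[𝕜] (H →L[𝕜] H)),
      (∀ a, ‖ρ a‖ ≤ ‖a‖) ∧ ¬ IsCompletelyContractive 𝕜 ρ.toLinearMap := by
  obtain ⟨ρ, hρe, hρ⟩ := exists_algHom_range φ ψ h
  have := completeSpace_subalgebra 𝕜 φ.range
  -- Lifting the finite-dimensional, hence complete, range makes the example available in every
  -- universe.
  let u : ULift.{u} φ.range →ₐ[𝕜] φ.range := (ULift.algEquiv (R := 𝕜)).toAlgHom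
  refine ⟨⟨OAlg.ofRepresentation (φ.range.val.comp u) fun _ => rfl, ULift.instCompleteSpace⟩,
    ρ.comp u, fun a => hρ a.down, fun hcc => ?_⟩
  have h1 : ‖opMatrix n ((x.map φ.rangeRestrict).map ρ)‖ ≤ ‖opMatrix n (x.map φ)‖ :=
    hcc n (x.map fun a => ULift.up (φ.rangeRestrict a))
  have h2 : (x.map φ.rangeRestrict).map ρ = x.map ψ := by
    ext1 i j
    exact hρe _
  rw [h2] at h1
  exact h1.not_gt hx

/-! ### Norms of a row of columns and of its entrywise transpose -/

/-- The two column units place the leading coordinates of the two input vectors in different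
positions, so the output norm is at most the input norm. -/
theorem norm_opMatrix_columns_le : ‖opMatrix 2
    !![matrixToOperator 𝕜 3 (columnMatrix (Pi.single 0 1)),
      matrixToOperator 𝕜 3 (columnMatrix (Pi.single 1 1)); 0, 0]‖ ≤ 1 := by
  refine ContinuousLinearMap.opNorm_le_bound _ zero_le_one fun v => ?_
  refine le_of_sq_le_sq ?_ (by positivity)
  rw [one_mul, PiLp.norm_sq_eq_of_L2, PiLp.norm_sq_eq_of_L2, Fin.sum_univ_two, Fin.sum_univ_two,
    opMatrix_apply, opMatrix_apply, Fin.sum_univ_two, Fin.sum_univ_two]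
  have h0 : matrixToOperator 𝕜 3 (columnMatrix (Pi.single 0 1)) (v 0) +
      matrixToOperator 𝕜 3 (columnMatrix (Pi.single 1 1)) (v 1) =
        WithLp.toLp 2 ![0, v 0 0, v 1 0] := by
    ext i
    rw [PiLp.add_apply, matrixToOperator_apply, matrixToOperator_apply]
    fin_cases i <;> simp [columnMatrix, Fin.sum_univ_three]
  simp only [Matrix.of_apply, Matrix.cons_val_zero, Matrix.cons_val_one, Matrix.cons_val', h0,
    zero_apply, add_zero, norm_zero]
  simp only [EuclideanSpace.norm_sq_eq, Fin.sum_univ_three]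
  simp
  nlinarith [sq_nonneg ‖v 0 1‖, sq_nonneg ‖v 0 2‖, sq_nonneg ‖v 1 1‖, sq_nonneg ‖v 1 2‖]

/-- After transposition both units write to the same coordinate: the vector `(e₁, e₂)` of squared
norm `2` has image with first component `2 e₀`, of squared norm `4`. -/
theorem one_lt_norm_opMatrix_rows : 1 < ‖opMatrix 2
    !![matrixToOperator 𝕜 3 (columnMatrix (Pi.single 0 1)).transpose,
      matrixToOperator 𝕜 3 (columnMatrix (Pi.single 1 1)).transpose; 0, 0]‖ := by
  by_contra! hle
  let v : PiLp 2 fun _ : Fin 2 => EuclideanSpace 𝕜 (Fin 3) :=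
    WithLp.toLp 2 ![EuclideanSpace.single 1 1, EuclideanSpace.single 2 1]
  have hv : ‖v‖ ^ 2 = 2 := by
    rw [PiLp.norm_sq_eq_of_L2, Fin.sum_univ_two]
    simp [v]
    norm_num
  have h2 : opMatrix 2 !![matrixToOperator 𝕜 3 (columnMatrix (Pi.single 0 1)).transpose,
      matrixToOperator 𝕜 3 (columnMatrix (Pi.single 1 1)).transpose; 0, 0] v 0 =
      WithLp.toLp 2 ![2, 0, 0] := by
    rw [opMatrix_apply, Fin.sum_univ_two]
    ext i
    rw [PiLp.add_apply]
    simp only [Matrix.of_apply, Matrix.cons_val_zero, Matrix.cons_val_one, Matrix.cons_val',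
      matrixToOperator_apply]
    fin_cases i <;> simp [columnMatrix, v]
    norm_num
  have h4 := pow_le_pow_left₀ (norm_nonneg _) (ContinuousLinearMap.le_of_opNorm_le _ hle v) 2
  rw [one_mul, hv, PiLp.norm_sq_eq_of_L2, Fin.sum_univ_two, h2] at h4
  have h5 : ‖(WithLp.toLp 2 ![2, 0, 0] : EuclideanSpace 𝕜 (Fin 3))‖ ^ 2 = 4 := by
    simp [EuclideanSpace.norm_sq_eq, Fin.sum_univ_three]
    norm_num
  rw [h5] at h4
  nlinarith [sq_nonneg ‖opMatrix 2 !![matrixToOperator 𝕜 3 (columnMatrix (Pi.single 0 1)).transpose,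
      matrixToOperator 𝕜 3 (columnMatrix (Pi.single 1 1)).transpose; 0, 0] v 1‖]

theorem OAlgHat.exists_representation_not_completelyContractive (𝕜 : Type) [RCLike 𝕜] :
    ∃ (A : OAlgHat.{u} 𝕜) (ρ : A.obj →ₐ[𝕜]
      (EuclideanSpace 𝕜 (Fin 3) →L[𝕜] EuclideanSpace 𝕜 (Fin 3))),
      (∀ a, ‖ρ a‖ ≤ ‖a‖) ∧ ¬ IsCompletelyContractive 𝕜 ρ.toLinearMap := by
  refine OAlgHat.exists_of_representations ((matrixToOperator 𝕜 3).comp columnRep)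
    ((matrixToOperator 𝕜 3).comp rowRep) (fun t => l2_opNorm_transpose_le (columnRep t)) 2
    !![TrivSqZeroExt.inr (Pi.single 0 1), TrivSqZeroExt.inr (Pi.single 1 1); 0, 0] ?_
  have hmap : ∀ (f : TrivSqZeroExt 𝕜 (Fin 2 → 𝕜) →ₐ[𝕜]
      (EuclideanSpace 𝕜 (Fin 3) →L[𝕜] EuclideanSpace 𝕜 (Fin 3)))
      (a b : TrivSqZeroExt 𝕜 (Fin 2 → 𝕜)),
      (!![a, b; 0, 0]).map f = !![f a, f b; 0, 0] := fun f a b => by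
    ext1 i j
    fin_cases i <;> fin_cases j <;> first | rfl | exact map_zero f
  rw [hmap, hmap]
  simp only [AlgHom.comp_apply, rowRep_apply, columnRep_inr]
  exact norm_opMatrix_columns_le.trans_lt one_lt_norm_opMatrix_rows

end ColumnAlgebra

theorem mainTheorem10 (𝕜 : Type) [RCLike 𝕜] :
    -- both forgetful functors have left adjoints
    (OAlg.forget.{u} 𝕜).IsRightAdjoint ∧
    (OAlgHat.forget.{u} 𝕜).IsRightAdjoint ∧
    -- operator algebras with a contractive, not completely contractive representation
    (∀ (A : OAlg.{u} 𝕜) (H : Type v) [NormedAddCommGroup H] [InnerProductSpace 𝕜 H]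
      [CompleteSpace H] (ρ : A →ₐ[𝕜] (H →L[𝕜] H)), (∀ a, ‖ρ a‖ ≤ ‖a‖) →
      ¬ IsCompletelyContractive 𝕜 ρ.toLinearMap →
      (∀ (F : NAlg.{u} 𝕜 ⥤ OAlg.{u} 𝕜) (adj : F ⊣ OAlg.forget.{u} 𝕜),
        Function.Bijective (OAlg.algHom (adj.counit.app A)) ∧
        ¬ IsCompletelyIsometric 𝕜 (OAlg.algHom (adj.counit.app A)).toLinearMap ∧
        ¬ IsRegularEpi (adj.counit.app A) ∧
        ∃ B : OAlg.{u} 𝕜, ¬ Function.Surjective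
          fun f : A ⟶ B => (Monad.comparison adj).map f) ∧
      (∃ (B : OAlg.{u} 𝕜) (f : B ⟶ A), Function.Bijective (OAlg.algHom f) ∧
        (∀ b, ‖OAlg.algHom f b‖ = ‖b‖) ∧
        ¬ IsCompletelyIsometric 𝕜 (OAlg.algHom f).toLinearMap ∧
        IsIso ((OAlg.forget 𝕜).map f) ∧ ¬ IsIso f) ∧
      ¬ IsPreMonadic (OAlg.forget.{u} 𝕜) ∧
      ¬ IsMonadic (OAlg.forget.{u} 𝕜)) ∧
    -- the same for complete operator algebras
    (∀ (A : OAlgHat.{u} 𝕜) (H : Type v) [NormedAddCommGroup H] [InnerProductSpace 𝕜 H]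
      [CompleteSpace H] (ρ : A.obj →ₐ[𝕜] (H →L[𝕜] H)), (∀ a, ‖ρ a‖ ≤ ‖a‖) →
      ¬ IsCompletelyContractive 𝕜 ρ.toLinearMap →
      (∀ (F : NAlgHat.{u} 𝕜 ⥤ OAlgHat.{u} 𝕜) (adj : F ⊣ OAlgHat.forget.{u} 𝕜),
        Function.Bijective (OAlg.algHom (adj.counit.app A).hom) ∧
        ¬ IsCompletelyIsometric 𝕜 (OAlg.algHom (adj.counit.app A).hom).toLinearMap ∧
        ¬ IsRegularEpi (adj.counit.app A) ∧
        ∃ B : OAlgHat.{u} 𝕜, ¬ Function.Surjective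
          fun f : A ⟶ B => (Monad.comparison adj).map f) ∧
      (∃ (B : OAlgHat.{u} 𝕜) (f : B ⟶ A), Function.Bijective (OAlg.algHom f.hom) ∧
        (∀ b, ‖OAlg.algHom f.hom b‖ = ‖b‖) ∧
        ¬ IsCompletelyIsometric 𝕜 (OAlg.algHom f.hom).toLinearMap ∧
        IsIso ((OAlgHat.forget 𝕜).map f) ∧ ¬ IsIso f) ∧
      ¬ IsPreMonadic (OAlgHat.forget.{u} 𝕜) ∧
      ¬ IsMonadic (OAlgHat.forget.{u} 𝕜)) ∧
    -- for `n ≥ 3` the polydisc algebra `P(𝔻ⁿ)` has such a representation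
    (∀ n : ℕ, 3 ≤ n → ∃ (H : Type) (_ : NormedAddCommGroup H) (_ : InnerProductSpace ℂ H)
      (_ : CompleteSpace H) (ρ : polydiscAlgebra n →ₐ[ℂ] (H →L[ℂ] H)),
      (∀ p, ‖ρ p‖ ≤ ‖p‖) ∧ ¬ IsCompletelyContractive ℂ ρ.toLinearMap) ∧
    -- neither forgetful functor is pre-monadic or monadic
    ¬ IsPreMonadic (OAlg.forget.{u} 𝕜) ∧ ¬ IsMonadic (OAlg.forget.{u} 𝕜) ∧
    ¬ IsPreMonadic (OAlgHat.forget.{u} 𝕜) ∧ ¬ IsMonadic (OAlgHat.forget.{u} 𝕜) := by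
  obtain ⟨A, ρ, hρ, hn⟩ := OAlgHat.exists_representation_not_completelyContractive.{u} 𝕜
  -- One complete algebra settles both cases, since it is also an object of the larger category.
  have hpre := A.obj.not_isPreMonadic_of_representation ρ hρ hn
  have hpre' := A.not_isPreMonadic_of_representation ρ hρ hn
  refine ⟨OAlg.forget_isRightAdjoint, OAlgHat.forget_isRightAdjoint,
    fun A H _ _ _ ρ hρ hn => ⟨A.counit_of_representation ρ hρ hn,
      ⟨A.max, A.fromMax, Function.bijective_id, fun _ => rfl,
        A.not_isCompletelyIsometric_fromMax ρ hρ hn, inferInstance, A.not_isIso_fromMax ρ hρ hn⟩,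
      A.not_isPreMonadic_of_representation ρ hρ hn,
      fun h => A.not_isPreMonadic_of_representation ρ hρ hn h.isPreMonadic⟩,
    fun A H _ _ _ ρ hρ hn => ⟨A.counit_of_representation ρ hρ hn,
      ⟨A.max, A.fromMax, Function.bijective_id, fun _ => rfl,
        A.obj.not_isCompletelyIsometric_fromMax ρ hρ hn, inferInstance,
        A.not_isIso_fromMax ρ hρ hn⟩,
      A.not_isPreMonadic_of_representation ρ hρ hn,
      fun h => A.not_isPreMonadic_of_representation ρ hρ hn h.isPreMonadic⟩,
    exists_contractive_representation_polydiscAlgebra,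
    hpre, fun h => hpre h.isPreMonadic, hpre', fun h => hpre' h.isPreMonadic⟩
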